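/- Let $0<a<1$, $0<b<1$, let $P=P_{(a,b)}\subset\mathbb R^2$ be the closed filled-in quadrilateral with clockwise vertices $A=(0,1)$, $B=(a,1)$, $C=(1,b)$, $D=(0,0)$, and let $\lambda=1-b$. Let $S$ be the union of the four rays $\overrightarrow{AB},\overrightarrow{BC},\overrightarrow{CD},\overrightarrow{DA}$. For $x\in\mathbb R^2\setminus(P\cup S)$ let $v$ be the unique vertex of $P$ such that $P$ lies on the left of the ray from $x$ through $v$, and put $Tx=v+\lambda(v-x)$ (outer billiards with contraction). Let $X=\mathbb R^2\setminus\bigl(P\cup\bigcup_{n\ge0}T^{-n}S\bigr)$. Put $l=\lambda^{-1}+(1-a)\lambda^{-2}$ and, for $\varepsilon>0$, $$R_1=[-l+\varepsilon,0]\times[1,1+\varepsilon^2],\qquad R_2=[-l+\varepsilon,0]\times[1-\varepsilon^2,1].$$ At singular points $T$ is extended by one-sided continuity, as follows. A generalised orbit is a sequence $(s_n)_{n\ge0}$ in $\mathbb R^2$ that is a coordinatewise limit of genuine orbits $(T^nx)_{n\ge0}$, $x\in X$. A Borel probability measure $\mu$ on $\mathbb R^2$ is called $T$-invariant if it is the distribution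 of $s_0$ under some shift-invariant Borel probability measure on the space of generalised orbits (if $\mu(X)=1$, this is the usual invariance $T_*\mu=\mu$). Theorem. Suppose in addition that $a+b\le1$ and $a<1+\lambda-\lambda^3-\lambda^4$. Then, for all sufficiently small $\varepsilon>0$, the set $X\cap(R_1\cup R_2)$ is non-empty and all its points have the same $\omega$-limit set under $T$, which does not depend on $\varepsilon$; call it $K_{(a,b)}$. There is a unique $T$-invariant Borel probability measure $\mu_{(a,b)}$ supported on $K_{(a,b)}$, i.e. with $\mu_{(a,b)}(\mathbb R^2\setminus K_{(a,b)})=0$. Moreover, for every function $\phi$ that is real-valued and continuous on $\mathbb R^2\setminus\operatorname{int}P$, $\phi$ is $\mu_{(a,b)}$-integrable over $K_{(a,b)}$ and $$\lim_{n\to\infty}\frac1n\sum_{i=0}^{n-1}\phi(T^ix)=\int_{K_{(a,b)}}\phi\,d\mu_{(a,b)}$$ for all $x\in X\cap(R_1\cup R_2)$, for all sufficiently small $\varepsilon>0$; and if $b=0.4$ and $0.4\le a\le0.5$, this holds for all $x\in X$. -/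

import Mathlib

open MeasureTheory Filter Topology

namespace OuterBilliard

/-- The planar cross product; `0 < cross (v - x) (w - x)` says that `w` lies strictly to the left
of the ray from `x` through `v`. -/
def cross (u v : ℝ × ℝ) : ℝ := u.1 * v.2 - u.2 * v.1

/-- The closed filled-in polygon with the four vertices `V`. -/
def polygon (V : Fin 4 → ℝ × ℝ) : Set (ℝ × ℝ) := convexHull ℝ (Set.range V)

/-- `V i` is the vertex such that the polygon lies on the left of the ray from `x` through `V i`
(and touches this ray at `V i` only). -/
def IsTangentVertex (V : Fin 4 → ℝ × ℝ) (x : ℝ × ℝ) (i : Fin 4) : Prop :=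
  ∀ j, j ≠ i → 0 < cross (V i - x) (V j - x)

open Classical in
/-- The outer billiards map with contraction factor `lam`: the point `x` is sent to the point
`v + lam • (v - x)`, where `v` is the tangent vertex seen from `x`. Where there is no such vertex
the value is irrelevant (and set to `x`). -/
noncomputable def outerMap (V : Fin 4 → ℝ × ℝ) (lam : ℝ) (x : ℝ × ℝ) : ℝ × ℝ :=
  if h : ∃ i, IsTangentVertex V x i then V h.choose + lam • (V h.choose - x) else x

/-- The union of the singular rays, from `V i` through `V (i + 1)` (indices modulo 4), for vertices
listed clockwise. -/
def singularRays (V : Fin 4 → ℝ × ℝ) : Set (ℝ × ℝ) :=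
  {x | ∃ i : Fin 4, ∃ s : ℝ, 0 ≤ s ∧ x = V i + s • (V (i + 1) - V i)}

/-- The set of points outside the polygon all of whose forward iterates are defined. -/
def regularSet (V : Fin 4 → ℝ × ℝ) (lam : ℝ) : Set (ℝ × ℝ) :=
  (polygon V ∪ ⋃ n : ℕ, (outerMap V lam)^[n] ⁻¹' singularRays V)ᶜ

/-- The `ω`-limit set of a single point. -/
def omegaSet (V : Fin 4 → ℝ × ℝ) (lam : ℝ) (p : ℝ × ℝ) : Set (ℝ × ℝ) :=
  omegaLimit atTop (fun (n : ℕ) (x : ℝ × ℝ) => (outerMap V lam)^[n] x) {p}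

/-- Generalised orbits: the sequences `s` that are limits, in every coordinate, of genuine orbits
of regular points. At a singular point such a sequence continues by a one-sided limit of the map,
namely the one that belongs to the side from which the point is approached. A regular
point is the starting point of exactly one generalised orbit, its genuine orbit. -/
def generalisedOrbits (V : Fin 4 → ℝ × ℝ) (lam : ℝ) : Set (ℕ → ℝ × ℝ) :=
  closure ((fun x (n : ℕ) => (outerMap V lam)^[n] x) '' regularSet V lam)

/-- `μ` is an invariant Borel probability measure of the outer billiards map, extended to singular
points by continuity from one side: `μ` is the law of the initial point of a shift-invariant
probability measure on the space of generalised orbits. If `μ` is carried by the regular set, this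
is the usual invariance `μ.map T = μ`. -/
def IsInvariantProb (V : Fin 4 → ℝ × ℝ) (lam : ℝ) (μ : Measure (ℝ × ℝ)) : Prop :=
  ∃ M : Measure (ℕ → ℝ × ℝ), IsProbabilityMeasure M ∧ M (generalisedOrbits V lam)ᶜ = 0 ∧
    M.map (fun s n => s (n + 1)) = M ∧ M.map (fun s => s 0) = μ

/-- The Birkhoff averages along the orbit of `x` of every function that is continuous on the
complement of the open polygon converge to the integral of the function over `K`. -/
def BirkhoffConverges (V : Fin 4 → ℝ × ℝ) (lam : ℝ) (K : Set (ℝ × ℝ)) (μ : Measure (ℝ × ℝ))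
    (x : ℝ × ℝ) : Prop :=
  ∀ φ : ℝ × ℝ → ℝ, ContinuousOn φ (interior (polygon V))ᶜ →
    IntegrableOn φ K μ ∧
    Tendsto (fun n : ℕ => birkhoffAverage ℝ (outerMap V lam) φ n x) atTop (𝓝 (∫ y in K, φ y ∂μ))

/-- The quadrilateral with clockwise vertices `A = (0,1)`, `B = (a,1)`, `C = (1,b)`, `D = (0,0)`. -/
def quad (a b : ℝ) : Fin 4 → ℝ × ℝ := ![(0, 1), (a, 1), (1, b), (0, 0)]

/-- The number `l` such that `E = (-l, 1)`, for `lam = 1 - b`. -/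
noncomputable def lengthEA (a b : ℝ) : ℝ := (1 - b)⁻¹ + (1 - a) * (1 - b)⁻¹ ^ 2

/-- The closed rectangle resting on the segment from `(-l + ε, 1)` to `A = (0, 1)`, of height
`ε ^ 2`. -/
def rectR1 (a b ε : ℝ) : Set (ℝ × ℝ) :=
  Set.Icc (-lengthEA a b + ε) 0 ×ˢ Set.Icc 1 (1 + ε ^ 2)

/-- The mirror image of `rectR1` in the line `y = 1`. -/
def rectR2 (a b ε : ℝ) : Set (ℝ × ℝ) :=
  Set.Icc (-lengthEA a b + ε) 0 ×ˢ Set.Icc (1 - ε ^ 2) 1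

/-- The regular points in the two thin rectangles. -/
def regularRect (a b ε : ℝ) : Set (ℝ × ℝ) :=
  regularSet (quad a b) (1 - b) ∩ (rectR1 a b ε ∪ rectR2 a b ε)

/-- `K` is the unique attractor of the regular points in the two rectangles: their common
`ω`-limit set, for all sufficiently small `ε`. -/
def IsAttractor (a b : ℝ) (K : Set (ℝ × ℝ)) : Prop :=
  ∃ ε₀ > 0, ∀ ε, 0 < ε → ε < ε₀ →
    (regularRect a b ε).Nonempty ∧ ∀ p ∈ regularRect a b ε, omegaSet (quad a b) (1 - b) p = K

end OuterBilliard

namespace OuterBilliard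

/-! Write `lam = 1 - b`. Near the line y = 1, to the left of A, an orbit is reflected in D, then in
C, and then in A or B according to its side of the line. Points of the thin rectangle `lowerStrip`
return to it along the vertices D, C, B, A or D, C, B, D, C, A, that is after 4 or 6 steps. The
bound a < 1 + lam - lam^3 - lam^4 says that the second image of the base segment stays to the right
of B, which makes this itinerary possible; a ≤ lam keeps the return of the short branch inside the
strip. Heights over the line only shrink. The horizontal coordinate, rescaled to the unit interval,
undergoes a contracted rotation: its lift `returnLift` is strictly increasing of degree one, with
slopes lam^4 and lam^6 and a jump at every integer, and the branch taken is recorded by whether the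
lift crosses an integer (`return_spec`).

Two facts about a strictly increasing degree one lift Φ drive the argument. The position of a point
relative to the fractional parts of 0, Φ 0, ..., Φ^m 0 determines the last m integer crossings
(`floor_increment_eq_of_orbitLabel_eq`). Moreover, the indicator of each such position is built from
differences ⌊Φ^j y⌋ - ⌊y⌋, whose sums telescope; so every position is visited at a rate given by the
translation number, with an error bounded uniformly in the orbit (`hasUniformRate_orbitLabel`).
Passing from returns to single time steps keeps this uniformity (`exists_time_labels`). As every
return contracts, points with the same long label are close, and the labels describe orbits to any
precision: this is `HasUniformLabels`, proved in `hasUniformLabels_basin`.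

The rest is soft (`exists_uniquely_ergodic_attractor`). Labels recur along all orbits or along none,
so the limit sets agree; Birkhoff sums of a continuous function are uniformly close to linear. An
invariant measure exists by averaging over shifts in the space of sequences, where the shift is
continuous although the map is not. It is unique because the Birkhoff estimate passes to limits of
orbits and can be integrated.

For lam = 3/5 and a ≤ 1/2, all orbits enter a fixed box, and the distance of the height to y = 1, or
to y = -3/5 when the next vertex is C, contracts; so every regular orbit reaches the strip
(`exists_mem_basin`). -/

/-- The standing assumptions on the parameters, with `lam = 1 - b`. -/
structure Admissible (a b lam : ℝ) : Prop where
  a_pos : 0 < a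
  a_lt_one : a < 1
  b_pos : 0 < b
  lam_pos : 0 < lam
  b_eq : b = 1 - lam
  a_le : a ≤ lam
  a_lt : a < 1 + lam - lam ^ 3 - lam ^ 4

/-! ### Tangent vertices and the map outside a general quadrilateral -/

section General

variable {V : Fin 4 → ℝ × ℝ} {lam : ℝ} {x : ℝ × ℝ}

lemma cross_swap (u v : ℝ × ℝ) : cross v u = -cross u v := by
  simp only [cross]; ring

lemma IsTangentVertex.unique {i j : Fin 4} (hi : IsTangentVertex V x i)
    (hj : IsTangentVertex V x j) : i = j := by
  by_contra h
  have h1 := hi j (Ne.symm h)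
  have h2 := hj i h
  rw [cross_swap] at h2
  linarith

lemma IsTangentVertex.outerMap_eq {i : Fin 4} (hi : IsTangentVertex V x i) :
    outerMap V lam x = V i + lam • (V i - x) := by
  have h : ∃ i, IsTangentVertex V x i := ⟨i, hi⟩
  have h2 : h.choose = i := h.choose_spec.unique hi
  rw [outerMap, dif_pos h, h2]

/-- The outer billiards map sends points with a tangent vertex to points outside the polygon. -/
lemma IsTangentVertex.outerMap_notMem {i : Fin 4} (hi : IsTangentVertex V x i) (hlam : 0 < lam) :
    outerMap V lam x ∉ polygon V := by
  rw [hi.outerMap_eq]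
  intro hmem
  obtain ⟨w, hw0, hw1, hw⟩ : ∃ w : Fin 4 → ℝ, (∀ j, 0 ≤ w j) ∧ ∑ j, w j = 1 ∧
      ∑ j, w j • V j = V i + lam • (V i - x) := by
    rw [polygon, convexHull_range_eq_exists_affineCombination] at hmem
    obtain ⟨s, w, hw0, hw1, hw⟩ := hmem
    refine ⟨fun j => if j ∈ s then w j else 0, fun j => ?_, ?_, ?_⟩
    · dsimp only
      split_ifs with h
      · exact hw0 j h
      · exact le_rfl
    · rw [← hw1]; simp
    · rw [← hw, Finset.affineCombination_eq_linear_combination _ _ _ hw1]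
      simp [ite_smul]
  -- The image lies on the tangent line, so its cross product with the direction vanishes. This is a
  -- weighted sum of cross products that are positive except at `V i`, so all the weight sits at `V
  -- i`.
  have key : ∑ j, w j * cross (V i - x) (V j - x) = 0 := by
    have h1 : ∑ j, w j * cross (V i - x) (V j - x)
        = cross (V i - x) (∑ j, w j • V j - (∑ j, w j) • x) := by
      simp only [Fin.sum_univ_four, cross, Prod.fst_sub, Prod.snd_sub, Prod.fst_add, Prod.snd_add,
        Prod.smul_fst, Prod.smul_snd, smul_eq_mul]
      ring
    rw [h1, hw, hw1]
    simp only [cross, Prod.fst_sub, Prod.snd_sub, Prod.fst_add, Prod.snd_add,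
        Prod.smul_fst, Prod.smul_snd, smul_eq_mul]
    ring
  have hself : cross (V i - x) (V i - x) = 0 := by simp only [cross]; ring
  have hnn : ∀ j ∈ Finset.univ, 0 ≤ w j * cross (V i - x) (V j - x) := by
    intro j _
    by_cases h : j = i
    · rw [h, hself, mul_zero]
    · exact mul_nonneg (hw0 j) (hi j h).le
  have hz := (Finset.sum_eq_zero_iff_of_nonneg hnn).1 key
  have hwz : ∀ j, j ≠ i → w j = 0 := fun j hj =>
    (mul_eq_zero.1 (hz j (Finset.mem_univ j))).resolve_right (hi j hj).ne'
  have hwi : w i = 1 := by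
    rw [← hw1]; exact (Finset.sum_eq_single i (fun j _ hj => hwz j hj) (by simp)).symm
  have hsum : ∑ j, w j • V j = V i := by
    rw [Finset.sum_eq_single i (fun j _ hj => by rw [hwz j hj, zero_smul]) (by simp), hwi, one_smul]
  have h0 : lam • (V i - x) = 0 := by
    rw [hsum] at hw
    simpa using hw
  have hVx : V i - x = 0 := (smul_eq_zero.1 h0).resolve_left hlam.ne'
  obtain ⟨j, hj⟩ : ∃ j : Fin 4, j ≠ i := exists_ne i
  have := hi j hj
  rw [hVx] at this
  simp [cross] at this

lemma regularSet_iff : x ∈ regularSet V lam ↔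
    x ∉ polygon V ∧ ∀ n : ℕ, (outerMap V lam)^[n] x ∉ singularRays V := by
  simp [regularSet]

end General

/-! ### The four regions of the quadrilateral and the formulas for the map on them -/

section Quad

variable {a b lam x y : ℝ}

/-- The four open regions of the plane, according to the tangent vertex. -/
def regionA : Set (ℝ × ℝ) := {p | 0 < p.1 ∧ 1 < p.2}
def regionB (a lam : ℝ) : Set (ℝ × ℝ) := {p | p.2 < 1 ∧ (1 - a) * (1 - p.2) < lam * (p.1 - a)}
def regionC (a b lam : ℝ) : Set (ℝ × ℝ) :=
  {p | p.2 < b * p.1 ∧ lam * (p.1 - a) < (1 - a) * (1 - p.2)}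
def regionD (b : ℝ) : Set (ℝ × ℝ) := {p | p.1 < 0 ∧ b * p.1 < p.2}

lemma isTangentVertex_A (h : Admissible a b lam) (hp : (x, y) ∈ regionA) :
    IsTangentVertex (quad a b) (x, y) 0 := by
  obtain ⟨h1, h2, h3, h4, rfl, h5, h6⟩ := h
  obtain ⟨hx, hy⟩ := hp
  simp only at hx hy
  intro j hj
  fin_cases j <;> simp [quad, cross] at hj ⊢ <;> nlinarith [mul_pos h1 (sub_pos.2 hy), mul_pos h4 hx]

lemma isTangentVertex_B (h : Admissible a b lam) (hp : (x, y) ∈ regionB a lam) :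
    IsTangentVertex (quad a b) (x, y) 1 := by
  obtain ⟨h1, h2, h3, h4, rfl, h5, h6⟩ := h
  obtain ⟨hy, hr⟩ := hp
  simp only at hr hy
  have hxa : a < x := by
    have : 0 < lam * (x - a) := lt_trans (mul_pos (sub_pos.2 h2) (sub_pos.2 hy)) hr
    have := pos_of_mul_pos_right this h4.le
    linarith
  intro j hj
  fin_cases j <;> simp [quad, cross] at hj ⊢ <;> nlinarith [mul_pos h1 (sub_pos.2 hy)]

lemma isTangentVertex_C (h : Admissible a b lam) (hp : (x, y) ∈ regionC a b lam) :
    IsTangentVertex (quad a b) (x, y) 2 := by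
  obtain ⟨h1, h2, h3, h4, rfl, h5, h6⟩ := h
  obtain ⟨hy, hr⟩ := hp
  simp only at hr hy
  -- The point lies below the diagonal AC: the required inequality is a positive combination of the
  -- two that define the region.
  have hA : 0 < 1 - y - lam * x := by
    have hd : 0 < 1 - a * (1 - lam) := by nlinarith
    have : 0 < (1 - a * (1 - lam)) * (1 - y - lam * x) := by
      nlinarith [mul_pos (mul_pos h1 h4) (sub_pos.2 hy)]
    exact pos_of_mul_pos_right this hd.le
  intro j hj
  fin_cases j <;> simp [quad, cross] at hj ⊢ <;> nlinarith

lemma isTangentVertex_D (h : Admissible a b lam) (hp : (x, y) ∈ regionD b) :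
    IsTangentVertex (quad a b) (x, y) 3 := by
  obtain ⟨h1, h2, h3, h4, rfl, h5, h6⟩ := h
  obtain ⟨hx, hy⟩ := hp
  simp only at hx hy
  -- The same for the diagonal DB.
  have hB : 0 < a * y - x := by
    have hd : 0 < 1 - a * (1 - lam) := by nlinarith
    nlinarith [mul_pos h1 (sub_pos.2 hy), mul_pos hd (neg_pos.2 hx)]
  intro j hj
  fin_cases j <;> simp [quad, cross] at hj ⊢ <;> nlinarith

lemma outerMap_A (h : Admissible a b lam) (hp : (x, y) ∈ regionA) :
    outerMap (quad a b) lam (x, y) = (-lam * x, 1 + lam - lam * y) := by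
  rw [(isTangentVertex_A h hp).outerMap_eq]
  ext <;> simp [quad]; ring

lemma outerMap_B (h : Admissible a b lam) (hp : (x, y) ∈ regionB a lam) :
    outerMap (quad a b) lam (x, y) = ((1 + lam) * a - lam * x, 1 + lam - lam * y) := by
  rw [(isTangentVertex_B h hp).outerMap_eq]
  ext <;> simp [quad] <;> ring

lemma outerMap_C (h : Admissible a b lam) (hp : (x, y) ∈ regionC a b lam) :
    outerMap (quad a b) lam (x, y) = (1 + lam - lam * x, 1 - lam ^ 2 - lam * y) := by
  rw [(isTangentVertex_C h hp).outerMap_eq]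
  ext <;> simp [quad, h.b_eq] <;> ring

lemma outerMap_D (h : Admissible a b lam) (hp : (x, y) ∈ regionD b) :
    outerMap (quad a b) lam (x, y) = (-lam * x, -lam * y) := by
  rw [(isTangentVertex_D h hp).outerMap_eq]
  ext <;> simp [quad]

lemma mem_singularRays_AB (ha : 0 < a) (hx : 0 ≤ x) : (x, (1 : ℝ)) ∈ singularRays (quad a b) :=
  ⟨0, x / a, by positivity, by ext <;> simp [quad, ha.ne']⟩

lemma mem_singularRays_BC (ha : a < 1) (hx : a ≤ x)
    (hy : (1 - b) * (x - a) = (1 - a) * (1 - y)) : (x, y) ∈ singularRays (quad a b) := by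
  have h1 : 1 - a ≠ 0 := by linarith
  refine ⟨1, (x - a) / (1 - a), div_nonneg (by linarith) (by linarith), ?_⟩
  ext
  · simp [quad]; field_simp; ring
  · simp [quad]; field_simp; linarith

lemma mem_singularRays_CD (hx : x ≤ 1) (hy : y = b * x) : (x, y) ∈ singularRays (quad a b) := by
  refine ⟨2, 1 - x, by linarith, ?_⟩
  ext <;> simp [quad, hy]; ring

lemma mem_singularRays_DA (hy : 0 ≤ y) : ((0 : ℝ), y) ∈ singularRays (quad a b) :=
  ⟨3, y, hy, by ext <;> simp [quad]⟩

lemma mem_polygon_of_comb (w : Fin 4 → ℝ) (hw : ∀ i, 0 ≤ w i) (h1 : ∑ i, w i = 1)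
    (hx : x = w 1 * a + w 2) (hy : y = w 0 + w 1 + w 2 * b) : (x, y) ∈ polygon (quad a b) := by
  have h2 : ∑ i, w i • quad a b i ∈ polygon (quad a b) :=
    (convex_convexHull ℝ _).sum_mem (fun i _ => hw i) h1
      (fun i _ => subset_convexHull ℝ _ (Set.mem_range_self i))
  convert h2 using 1
  ext <;> simp [Fin.sum_univ_four, quad, hx, hy]

lemma mem_polygon (h : Admissible a b lam) (hx : 0 ≤ x) (hy : y ≤ 1) (hCD : b * x ≤ y)
    (hBC : lam * (x - a) ≤ (1 - a) * (1 - y)) : (x, y) ∈ polygon (quad a b) := by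
  obtain ⟨h1, h2, h3, h4, rfl, h5, h6⟩ := h
  by_cases hc : 1 - y ≤ lam * x
  · -- the triangle with vertices `A`, `B`, `C`
    have hd : 0 < lam * a := mul_pos h4 h1
    have e1 : 0 ≤ (1 - y) / lam := div_nonneg (by linarith) h4.le
    have e2 : (x - (1 - y) / lam) / a = (lam * x - (1 - y)) / (lam * a) := by field_simp
    have e3 : 0 ≤ (x - (1 - y) / lam) / a := by
      rw [e2]; exact div_nonneg (by linarith) hd.le
    refine mem_polygon_of_comb ![1 - (1 - y) / lam - (x - (1 - y) / lam) / a,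
      (x - (1 - y) / lam) / a, (1 - y) / lam, 0] ?_ ?_ ?_ ?_
    · intro i
      fin_cases i
      · have : 1 - (1 - y) / lam - (x - (1 - y) / lam) / a
          = ((1 - a) * (1 - y) - lam * (x - a)) / (lam * a) := by field_simp; ring
        simp only [Fin.zero_eta, Matrix.cons_val_zero]
        rw [this]; exact div_nonneg (by linarith) hd.le
      · simpa using e3
      · simpa using e1
      · simp
    · simp [Fin.sum_univ_four]
    · simp; field_simp; ring
    · simp; field_simp; ring
  · -- the triangle with vertices `A`, `C`, `D`
    refine mem_polygon_of_comb ![y - (1 - lam) * x, 0, x, 1 - y - lam * x] ?_ ?_ ?_ ?_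
    · intro i
      fin_cases i
      · simp; linarith
      · simp
      · simpa using hx
      · simp; linarith
    · simp [Fin.sum_univ_four]; ring
    · simp
    · simp; ring

/-- The open regions are cut out by the lines carrying the sides; ties in the sign tests fall on
singular rays, apart from those on y = 1 left of A, which belong to the region of D. -/
lemma mem_region (h : Admissible a b lam) (hP : (x, y) ∉ polygon (quad a b))
    (hS : (x, y) ∉ singularRays (quad a b)) :
    (x, y) ∈ regionA ∨ (x, y) ∈ regionB a lam ∨ (x, y) ∈ regionC a b lam ∨ (x, y) ∈ regionD b := by
  have h' := h
  obtain ⟨h1, h2, h3, h4, hb, h5, h6⟩ := h'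
  simp only [regionA, regionB, regionC, regionD, Set.mem_ofPred_eq]
  have hbl : 1 - b = lam := by linarith
  rcases lt_trichotomy y 1 with hy | hy | hy
  · rcases lt_trichotomy ((1 - a) * (1 - y)) (lam * (x - a)) with hr | hr | hr
    · exact Or.inr (Or.inl ⟨hy, hr⟩)
    · have : 0 < lam * (x - a) := hr ▸ mul_pos (sub_pos.2 h2) (sub_pos.2 hy)
      have := pos_of_mul_pos_right this h4.le
      exact absurd (mem_singularRays_BC h2 (by linarith) (by rw [hbl, hr])) hS
    · rcases lt_trichotomy y (b * x) with hc | hc | hc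
      · exact Or.inr (Or.inr (Or.inl ⟨hc, hr⟩))
      · have hx1 : x < 1 := by
          by_contra hx1
          push Not at hx1
          subst hc
          rw [hb] at hr
          nlinarith [mul_nonneg h4.le (sub_nonneg.2 hx1),
            mul_nonneg (mul_nonneg (sub_nonneg.2 h2.le) h3.le) (sub_nonneg.2 hx1)]
        exact absurd (mem_singularRays_CD hx1.le hc) hS
      · rcases lt_trichotomy x 0 with hx | hx | hx
        · exact Or.inr (Or.inr (Or.inr ⟨hx, hc⟩))
        · subst hx
          exact absurd (mem_singularRays_DA (by linarith)) hS
        · exact absurd (mem_polygon h hx.le hy.le hc.le hr.le) hP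
  · subst hy
    rcases lt_or_ge x 0 with hx | hx
    · exact Or.inr (Or.inr (Or.inr ⟨hx, by nlinarith⟩))
    · exact absurd (mem_singularRays_AB h1 hx) hS
  · rcases lt_trichotomy x 0 with hx | hx | hx
    · exact Or.inr (Or.inr (Or.inr ⟨hx, by nlinarith⟩))
    · subst hx
      exact absurd (mem_singularRays_DA (by linarith)) hS
    · exact Or.inl ⟨hx, hy⟩

lemma exists_isTangentVertex (h : Admissible a b lam) {p : ℝ × ℝ} (hP : p ∉ polygon (quad a b))
    (hS : p ∉ singularRays (quad a b)) : ∃ i, IsTangentVertex (quad a b) p i := by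
  obtain ⟨x, y⟩ := p
  rcases mem_region h hP hS with hr | hr | hr | hr
  · exact ⟨_, isTangentVertex_A h hr⟩
  · exact ⟨_, isTangentVertex_B h hr⟩
  · exact ⟨_, isTangentVertex_C h hr⟩
  · exact ⟨_, isTangentVertex_D h hr⟩

lemma outerMap_mem_regularSet (h : Admissible a b lam) {p : ℝ × ℝ}
    (hp : p ∈ regularSet (quad a b) lam) : outerMap (quad a b) lam p ∈ regularSet (quad a b) lam := by
  rw [regularSet_iff] at hp ⊢
  obtain ⟨i, hi⟩ := exists_isTangentVertex h hp.1 (hp.2 0)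
  exact ⟨hi.outerMap_notMem h.lam_pos, fun n => hp.2 (n + 1)⟩

lemma iterate_mem_regularSet (h : Admissible a b lam) {p : ℝ × ℝ}
    (hp : p ∈ regularSet (quad a b) lam) (n : ℕ) :
    (outerMap (quad a b) lam)^[n] p ∈ regularSet (quad a b) lam := by
  induction n with
  | zero => exact hp
  | succ n ih => rw [Function.iterate_succ_apply']; exact outerMap_mem_regularSet h ih

lemma notMem_singularRays {p : ℝ × ℝ} (hp : p ∈ regularSet (quad a b) lam) :
    p ∉ singularRays (quad a b) := (regularSet_iff.1 hp).2 0

lemma notMem_polygon {p : ℝ × ℝ} (hp : p ∈ regularSet (quad a b) lam) :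
    p ∉ polygon (quad a b) := (regularSet_iff.1 hp).1

end Quad

/-! ### Orbit labels and bounded discrepancy for degree one circle lifts -/

section Circle

variable (Φ : CircleDeg1Lift)

/-- The label of depth `m` of a point of the circle records its position relative to the first
`m + 1` iterates of `0`. -/
noncomputable def orbitLabel (m : ℕ) (t : ℝ) : Fin (m + 1) → Bool :=
  fun j => decide (t < Int.fract ((Φ ^ (j : ℕ)) 0))

variable {Φ}

/-- With n = ⌊y⌋, monotonicity and commutation with integer translations put Φ^j y in [Φ^j 0 + n,
Φ^j 0 + n + 1). Only two integer parts are possible there, and comparing fractional parts tells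
which. Strictness of Φ keeps the right end open. -/
lemma floor_iterate_sub (hΦ : StrictMono Φ) (j : ℕ) (y : ℝ) :
    ⌊(Φ ^ j) y⌋ - ⌊y⌋ = ⌊(Φ ^ j) 0⌋ +
      if Int.fract ((Φ ^ j) y) < Int.fract ((Φ ^ j) 0) then 1 else 0 := by
  have hmono : StrictMono (Φ ^ j) := by
    rw [CircleDeg1Lift.coe_pow]; exact hΦ.iterate j
  have h0 : (Φ ^ j) (⌊y⌋ : ℝ) = (Φ ^ j) 0 + ⌊y⌋ := by
    have := (Φ ^ j).map_add_int 0 ⌊y⌋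
    rwa [zero_add] at this
  have h1 : (Φ ^ j) ((⌊y⌋ : ℝ) + 1) = (Φ ^ j) 0 + ⌊y⌋ + 1 := by
    rw [(Φ ^ j).map_add_one, h0]
  have hl : (Φ ^ j) 0 + ⌊y⌋ ≤ (Φ ^ j) y := h0 ▸ hmono.monotone (Int.floor_le y)
  have hu : (Φ ^ j) y < (Φ ^ j) 0 + ⌊y⌋ + 1 := h1 ▸ hmono (Int.lt_floor_add_one y)
  have e1 := Int.floor_add_fract ((Φ ^ j) y)
  have e2 := Int.floor_add_fract ((Φ ^ j) 0)
  have b1 := Int.fract_nonneg ((Φ ^ j) y)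
  have b2 := Int.fract_nonneg ((Φ ^ j) 0)
  have c1 := Int.fract_lt_one ((Φ ^ j) y)
  have c2 := Int.fract_lt_one ((Φ ^ j) 0)
  split_ifs with hc
  · have l1 : ((⌊(Φ ^ j) 0⌋ + ⌊y⌋ : ℤ) : ℝ) < ⌊(Φ ^ j) y⌋ := by push_cast; linarith
    have l2 : ((⌊(Φ ^ j) y⌋ : ℤ) : ℝ) < (⌊(Φ ^ j) 0⌋ + ⌊y⌋ + 2 : ℤ) := by push_cast; linarith
    have l3 := Int.cast_lt.1 l1
    have l4 := Int.cast_lt.1 l2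
    omega
  · have l1 : ((⌊(Φ ^ j) 0⌋ + ⌊y⌋ - 1 : ℤ) : ℝ) < ⌊(Φ ^ j) y⌋ := by push_cast; linarith
    have l2 : ((⌊(Φ ^ j) y⌋ : ℤ) : ℝ) < (⌊(Φ ^ j) 0⌋ + ⌊y⌋ + 1 : ℤ) := by push_cast; linarith
    have l3 := Int.cast_lt.1 l1
    have l4 := Int.cast_lt.1 l2
    omega

/-- Points with the same label have had the same recent increments. -/
lemma floor_increment_eq_of_orbitLabel_eq (hΦ : StrictMono Φ) {m : ℕ} {y z : ℝ}
    (h : orbitLabel Φ m (Int.fract ((Φ ^ m) y)) = orbitLabel Φ m (Int.fract ((Φ ^ m) z)))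
    {k : ℕ} (hk : k < m) :
    ⌊(Φ ^ (k + 1)) y⌋ - ⌊(Φ ^ k) y⌋ = ⌊(Φ ^ (k + 1)) z⌋ - ⌊(Φ ^ k) z⌋ := by
  -- View Φ^m y as the (m - k)-th iterate of Φ^k y: entry m - k of the label then gives the total
  -- increment since time k. Consecutive totals are subtracted at the end.
  have key : ∀ k ≤ m, ⌊(Φ ^ m) y⌋ - ⌊(Φ ^ k) y⌋ = ⌊(Φ ^ m) z⌋ - ⌊(Φ ^ k) z⌋ := by
    intro k hk
    have hpow : ∀ y : ℝ, (Φ ^ (m - k)) ((Φ ^ k) y) = (Φ ^ m) y := by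
      intro y
      rw [← CircleDeg1Lift.mul_apply, ← pow_add, Nat.sub_add_cancel hk]
    have hy := floor_iterate_sub hΦ (m - k) ((Φ ^ k) y)
    have hz := floor_iterate_sub hΦ (m - k) ((Φ ^ k) z)
    rw [hpow] at hy hz
    have hj := congrFun h ⟨m - k, by omega⟩
    simp only [orbitLabel, decide_eq_decide] at hj
    rw [hy, hz]
    simp only [hj]
  have h1 := key k hk.le
  have h2 := key (k + 1) hk
  omega

/-- The counting function of a property of orbit points grows linearly up to a bounded error, at
a rate that does not depend on the orbit. -/
def HasUniformRate (Φ : CircleDeg1Lift) (g : ℝ → ℝ) : Prop :=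
  ∃ f C : ℝ, ∀ (y : ℝ) (n : ℕ),
    |∑ i ∈ Finset.range n, g (Int.fract ((Φ ^ i) y)) - n * f| ≤ C

lemma HasUniformRate.sub {g h : ℝ → ℝ} (hg : HasUniformRate Φ g) (hh : HasUniformRate Φ h) :
    HasUniformRate Φ (fun t => g t - h t) := by
  obtain ⟨f₁, C₁, h₁⟩ := hg
  obtain ⟨f₂, C₂, h₂⟩ := hh
  refine ⟨f₁ - f₂, C₁ + C₂, fun y n => ?_⟩
  rw [Finset.sum_sub_distrib]
  have e1 := abs_le.1 (h₁ y n)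
  have e2 := abs_le.1 (h₂ y n)
  rw [abs_le]
  constructor <;> linarith

lemma HasUniformRate.congr {g h : ℝ → ℝ} (hg : HasUniformRate Φ g)
    (hgh : ∀ t, 0 ≤ t → t < 1 → g t = h t) : HasUniformRate Φ h := by
  obtain ⟨f, C, h⟩ := hg
  refine ⟨f, C, fun y n => ?_⟩
  rw [← Finset.sum_congr rfl fun i _ => hgh _ (Int.fract_nonneg _) (Int.fract_lt_one _)]
  exact h y n

lemma hasUniformRate_const (c : ℝ) : HasUniformRate Φ (fun _ => c) :=
  ⟨c, 0, fun y n => by simp⟩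

lemma abs_floor_iterate_sub_le (y : ℝ) (n : ℕ) :
    |(⌊(Φ ^ n) y⌋ : ℝ) - ⌊y⌋ - n * Φ.translationNumber| ≤ 2 := by
  have h1 := (Φ ^ n).map_lt_add_translationNumber_add_one y
  have h2 : y + (Φ ^ n).translationNumber - 1 < (Φ ^ n) y := by
    have h3 : (y : ℝ) + ⌊(Φ ^ n) y - y⌋ ≤ (Φ ^ n) y := by
      linarith [Int.floor_le ((Φ ^ n) y - y)]
    have h4 := (Φ ^ n).translationNumber_le_ceil_sub y
    have h5 := Int.ceil_lt_add_one ((Φ ^ n) y - y)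
    linarith
  rw [CircleDeg1Lift.translationNumber_pow] at h1 h2
  have e1 := Int.floor_le ((Φ ^ n) y)
  have e2 := Int.floor_le y
  have e3 := Int.lt_floor_add_one ((Φ ^ n) y)
  have e4 := Int.lt_floor_add_one y
  rw [abs_le]
  constructor <;> linarith

/-- Raising j by one adds a sum of consecutive differences, which telescopes to the floor
displacement of a single orbit segment; this costs 2 by the translation number estimate. -/
lemma abs_sum_floor_sub_le (y : ℝ) (n j : ℕ) :
    |∑ i ∈ Finset.range n, ((⌊(Φ ^ (i + j)) y⌋ : ℝ) - ⌊(Φ ^ i) y⌋)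
      - n * (j * Φ.translationNumber)| ≤ 2 * j := by
  induction j with
  | zero => simp
  | succ j ih =>
    have h1 : ∑ i ∈ Finset.range n, ((⌊(Φ ^ (i + (j + 1))) y⌋ : ℝ) - ⌊(Φ ^ i) y⌋)
        = ∑ i ∈ Finset.range n, ((⌊(Φ ^ (i + j)) y⌋ : ℝ) - ⌊(Φ ^ i) y⌋)
          + ((⌊(Φ ^ (n + j)) y⌋ : ℝ) - ⌊(Φ ^ j) y⌋) := by
      have h2 := Finset.sum_range_sub (fun i => (⌊(Φ ^ (i + j)) y⌋ : ℝ)) n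
      simp only [zero_add] at h2
      rw [← h2, ← Finset.sum_add_distrib]
      refine Finset.sum_congr rfl fun i _ => ?_
      rw [show i + (j + 1) = i + 1 + j by ring]
      ring
    have h3 := abs_floor_iterate_sub_le (Φ := Φ) ((Φ ^ j) y) n
    rw [← CircleDeg1Lift.mul_apply, ← pow_add] at h3
    rw [h1]
    have e1 := abs_le.1 ih
    have e2 := abs_le.1 h3
    push_cast
    rw [abs_le]
    constructor <;> linarith

lemma abs_sum_shift_sub_le {g : ℕ → ℝ} (h0 : ∀ i, 0 ≤ g i) (h1 : ∀ i, g i ≤ 1) (n j : ℕ) :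
    |∑ i ∈ Finset.range n, g (i + j) - ∑ i ∈ Finset.range n, g i| ≤ j := by
  have e1 : ∑ i ∈ Finset.range (n + j), g i
      = ∑ i ∈ Finset.range n, g i + ∑ i ∈ Finset.range j, g (n + i) :=
    Finset.sum_range_add _ _ _
  have e2 : ∑ i ∈ Finset.range (j + n), g i
      = ∑ i ∈ Finset.range j, g i + ∑ i ∈ Finset.range n, g (j + i) :=
    Finset.sum_range_add _ _ _
  have e3 : ∑ i ∈ Finset.range n, g (j + i) = ∑ i ∈ Finset.range n, g (i + j) :=
    Finset.sum_congr rfl fun i _ => by rw [add_comm]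
  rw [add_comm j n, e1, e3] at e2
  have bd : ∀ k : ℕ → ℕ, 0 ≤ ∑ i ∈ Finset.range j, g (k i) ∧
      ∑ i ∈ Finset.range j, g (k i) ≤ j := fun k =>
    ⟨Finset.sum_nonneg fun i _ => h0 _, by
      simpa using Finset.sum_le_card_nsmul (Finset.range j) (fun i => g (k i)) 1 fun i _ => h1 _⟩
  have b1 := bd (fun i => n + i)
  have b2 := bd (fun i => i)
  rw [abs_le]
  constructor <;> linarith [b1.1, b1.2, b2.1, b2.2]

/-- By `floor_iterate_sub` the indicator at time i + j is ⌊Φ^(i+j) y⌋ - ⌊Φ^i y⌋ minus a constant, so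
its sums are controlled by telescoping; moving the window by j costs at most j more. -/
lemma hasUniformRate_threshold (hΦ : StrictMono Φ) (j : ℕ) :
    HasUniformRate Φ (fun t => if t < Int.fract ((Φ ^ j) 0) then 1 else 0) := by
  refine ⟨j * Φ.translationNumber - ⌊(Φ ^ j) 0⌋, 2 * j + j, fun y n => ?_⟩
  set g : ℕ → ℝ := fun i => if Int.fract ((Φ ^ i) y) < Int.fract ((Φ ^ j) 0) then 1 else 0 with hg
  have h1 : ∀ i, g (i + j) = (⌊(Φ ^ (i + j)) y⌋ : ℝ) - ⌊(Φ ^ i) y⌋ - ⌊(Φ ^ j) 0⌋ := by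
    intro i
    have h2 := floor_iterate_sub hΦ j ((Φ ^ i) y)
    rw [← CircleDeg1Lift.mul_apply, ← pow_add, add_comm j i] at h2
    have h3 : ((⌊(Φ ^ (i + j)) y⌋ - ⌊(Φ ^ i) y⌋ : ℤ) : ℝ) = ⌊(Φ ^ j) 0⌋ + g (i + j) := by
      rw [h2, hg]
      push_cast
      rfl
    push_cast at h3
    linarith
  have h2 := abs_sum_shift_sub_le (g := g) (fun i => by simp only [hg]; split_ifs <;> norm_num)
    (fun i => by simp only [hg]; split_ifs <;> norm_num) n j
  have h3 := abs_sum_floor_sub_le (Φ := Φ) y n j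
  have h4 : ∑ i ∈ Finset.range n, g (i + j)
      = ∑ i ∈ Finset.range n, ((⌊(Φ ^ (i + j)) y⌋ : ℝ) - ⌊(Φ ^ i) y⌋) - n * ⌊(Φ ^ j) 0⌋ := by
    rw [Finset.sum_congr rfl fun i _ => h1 i, Finset.sum_sub_distrib]
    simp
  rw [h4] at h2
  change |∑ i ∈ Finset.range n, g i - _| ≤ _
  have e1 := abs_le.1 h2
  have e2 := abs_le.1 h3
  rw [abs_le]
  constructor <;> linarith

/-- The intersection of finitely many sets of the form `{t < c j}` or `{c j ≤ t}` is an interval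
whose endpoints are among the `c j` and the endpoints `0`, `1`. -/
lemma exists_interval {ι : Type*} (c : ι → ℝ) (w : ι → Bool) (s : Finset ι) :
    ∃ p q : ℝ, (p = 0 ∨ ∃ j, p = c j) ∧ (q = 1 ∨ ∃ j, q = c j) ∧
      ∀ t, 0 ≤ t → t < 1 → ((∀ j ∈ s, decide (t < c j) = w j) ↔ p ≤ t ∧ t < q) := by
  classical
  induction s using Finset.induction_on with
  | empty => exact ⟨0, 1, Or.inl rfl, Or.inl rfl, fun t h0 h1 => by simp [h0, h1]⟩
  | insert j s _ ih =>
    obtain ⟨p, q, hp, hq, h⟩ := ih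
    cases hw : w j with
    | true =>
      refine ⟨p, min q (c j), hp, ?_, fun t h0 h1 => ?_⟩
      · rcases min_choice q (c j) with e | e
        · rwa [e]
        · exact Or.inr ⟨j, e⟩
      · rw [Finset.forall_mem_insert, h t h0 h1, hw, lt_min_iff, decide_eq_true_iff]
        tauto
    | false =>
      refine ⟨max p (c j), q, ?_, hq, fun t h0 h1 => ?_⟩
      · rcases max_choice p (c j) with e | e
        · rwa [e]
        · exact Or.inr ⟨j, e⟩
      · rw [Finset.forall_mem_insert, h t h0 h1, hw, max_le_iff, decide_eq_false_iff_not, not_lt]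
        tauto

/-- A label class is a half-open interval whose ends are thresholds, so its indicator is a
difference of two threshold indicators, or zero when the ends are in the wrong order. -/
lemma hasUniformRate_orbitLabel (hΦ : StrictMono Φ) (m : ℕ) (w : Fin (m + 1) → Bool) :
    HasUniformRate Φ (fun t => if orbitLabel Φ m t = w then 1 else 0) := by
  obtain ⟨p, q, hp, hq, h⟩ := exists_interval
    (fun j : Fin (m + 1) => Int.fract ((Φ ^ (j : ℕ)) 0)) w Finset.univ
  have hp' : HasUniformRate Φ (fun t => if t < p then 1 else 0) := by
    rcases hp with rfl | ⟨j, rfl⟩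
    · exact (hasUniformRate_const 0).congr fun t h0 _ => by rw [if_neg h0.not_gt]
    · exact hasUniformRate_threshold hΦ j
  have hq' : HasUniformRate Φ (fun t => if t < q then 1 else 0) := by
    rcases hq with rfl | ⟨j, rfl⟩
    · exact (hasUniformRate_const 1).congr fun t _ h1 => by rw [if_pos h1]
    · exact hasUniformRate_threshold hΦ j
  have hlab : ∀ t, 0 ≤ t → t < 1 → (orbitLabel Φ m t = w ↔ p ≤ t ∧ t < q) := by
    intro t h0 h1
    rw [← h t h0 h1, funext_iff]
    simp [orbitLabel]
  by_cases hpq : p ≤ q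
  · refine (hq'.sub hp').congr fun t h0 h1 => ?_
    simp only [hlab t h0 h1]
    by_cases h2 : t < p
    · rw [if_pos h2, if_pos (by linarith), if_neg (by intro h; linarith [h.1]), sub_self]
    · rw [if_neg h2]
      simp [not_lt.1 h2]
  · refine (hasUniformRate_const 0).congr fun t h0 h1 => ?_
    rw [if_neg]
    rw [hlab t h0 h1]
    intro h
    linarith [h.1, h.2]

end Circle

/-! ### From frequencies of blocks to frequencies of times -/

section Suspension

variable {κ : Type} (h : κ → ℕ) (b : ℕ → κ) (e : ℕ)

/-- The starting time of the `k`-th block, when the first block starts at time `e` and a block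
with label `c` has length `h c`. -/
def blockStart (k : ℕ) : ℕ := e + ∑ i ∈ Finset.range k, h (b i)

@[simp] lemma blockStart_zero : blockStart h b e 0 = e := by simp [blockStart]

lemma blockStart_succ (k : ℕ) : blockStart h b e (k + 1) = blockStart h b e k + h (b k) := by
  simp [blockStart, Finset.sum_range_succ, add_assoc]

variable {h b e}

lemma blockStart_mono : Monotone (blockStart h b e) :=
  monotone_nat_of_le_succ fun k => by rw [blockStart_succ]; omega

lemma le_blockStart (k : ℕ) : e ≤ blockStart h b e k := Nat.le_add_right _ _

lemma exists_block (hpos : ∀ c, 1 ≤ h c) {n : ℕ} (hn : e ≤ n) :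
    ∃ k r, r < h (b k) ∧ n = blockStart h b e k + r := by
  induction n, hn using Nat.le_induction with
  | base => exact ⟨0, 0, hpos _, by simp⟩
  | succ n _ ih =>
    obtain ⟨k, r, hr, rfl⟩ := ih
    by_cases h1 : r + 1 < h (b k)
    · exact ⟨k, r + 1, h1, by ring⟩
    · exact ⟨k + 1, 0, hpos _, by rw [blockStart_succ]; omega⟩

lemma block_unique {k k' r r' : ℕ} (hr : r < h (b k)) (hr' : r' < h (b k'))
    (heq : blockStart h b e k + r = blockStart h b e k' + r') : k = k' ∧ r = r' := by
  have aux : ∀ {k k' r r' : ℕ}, r < h (b k) →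
      blockStart h b e k + r = blockStart h b e k' + r' → ¬ k < k' := by
    intro k k' r r' hr heq hlt
    have h1 := blockStart_mono (h := h) (b := b) (e := e) (Nat.succ_le_of_lt hlt)
    rw [Nat.succ_eq_add_one, blockStart_succ] at h1
    omega
  have h1 := aux hr heq
  have h2 := aux hr' heq.symm
  have h3 : k = k' := by omega
  subst h3
  exact ⟨rfl, by omega⟩

open Classical in
/-- If the labels of the blocks have uniform frequencies, then so do the labels of the times. -/
theorem exists_time_labels [Fintype κ] (h : κ → ℕ) (H : ℕ) (hpos : ∀ c, 1 ≤ h c)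
    (hH : ∀ c, h c ≤ H) (f : κ → ℝ) (C : ℝ) (N : ℕ) :
    ∃ (F : Option (κ × ℕ) → ℝ) (C' : ℝ), ∀ (b : ℕ → κ) (e : ℕ), e ≤ N →
      (∀ c k, |∑ i ∈ Finset.range k, (if b i = c then (1 : ℝ) else 0) - k * f c| ≤ C) →
      ∃ lab : ℕ → Option (κ × ℕ),
        (∀ n, (n < e ∧ lab n = none) ∨
          ∃ k r, r < h (b k) ∧ n = blockStart h b e k + r ∧ lab n = some (b k, r)) ∧
        ∀ c n, |∑ j ∈ Finset.range n, (if lab j = c then (1 : ℝ) else 0) - n * F c| ≤ C' := by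
  -- ℓ is the mean block length, and D bounds |n - k ℓ| for every time n in block k. The label (c,
  -- s), meaning step s of a block of type c, therefore has rate f c / ℓ; the label `none` marks the
  -- at most N times before the first block.
  set ℓ : ℝ := ∑ c, f c * h c with hℓ
  set D : ℝ := N + H + ∑ c : κ, |C| * h c with hD
  have hD0 : 0 ≤ D := by rw [hD]; positivity
  set F : Option (κ × ℕ) → ℝ := fun o => o.elim 0 fun p => if p.2 < h p.1 then f p.1 / ℓ else 0
    with hF
  refine ⟨F, N + H + |C| + (∑ c, |f c|) * D, ?_⟩
  intro b e he hfreq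
  have hC : ∀ c k, |∑ i ∈ Finset.range k, (if b i = c then (1 : ℝ) else 0) - k * f c| ≤ |C| :=
    fun c k => (hfreq c k).trans (le_abs_self C)
  -- the starting times grow linearly
  have hlin : ∀ k, |(blockStart h b e k : ℝ) - e - k * ℓ| ≤ ∑ c : κ, |C| * h c := by
    intro k
    have h1 : (blockStart h b e k : ℝ) - e
        = ∑ c : κ, (∑ i ∈ Finset.range k, (if b i = c then (1 : ℝ) else 0)) * h c := by
      simp_rw [Finset.sum_mul]
      rw [Finset.sum_comm]
      simp [blockStart]
    rw [h1, hℓ, Finset.mul_sum, ← Finset.sum_sub_distrib]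
    refine (Finset.abs_sum_le_sum_abs _ _).trans (Finset.sum_le_sum fun c _ => ?_)
    rw [← mul_assoc, ← sub_mul, abs_mul, Nat.abs_cast]
    exact mul_le_mul_of_nonneg_right (hC c k) (Nat.cast_nonneg _)
  have hge : ∀ k : ℕ, (k : ℝ) ≤ blockStart h b e k - e := by
    intro k
    have : ∑ i ∈ Finset.range k, 1 ≤ ∑ i ∈ Finset.range k, h (b i) :=
      Finset.sum_le_sum fun i _ => hpos _
    simp only [Finset.sum_const, Finset.card_range, smul_eq_mul, mul_one] at this
    have h2 : (k : ℝ) ≤ (∑ i ∈ Finset.range k, h (b i) : ℕ) := by exact_mod_cast this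
    rw [blockStart]
    push_cast at h2 ⊢
    linarith
  -- Blocks have length at least one, so the k-th start is at least e + k; it also equals e + k ℓ up
  -- to a bounded error.
  have hℓ1 : 1 ≤ ℓ := by
    by_contra hlt
    push Not at hlt
    obtain ⟨k, hk⟩ := exists_nat_gt ((∑ c : κ, |C| * h c) / (1 - ℓ))
    rw [div_lt_iff₀ (by linarith)] at hk
    have h1 := (abs_le.1 (hlin k)).2
    have h2 := hge k
    nlinarith
  have hex : ∀ n, ∃ o : Option (κ × ℕ), (n < e ∧ o = none) ∨
      ∃ k r, r < h (b k) ∧ n = blockStart h b e k + r ∧ o = some (b k, r) := by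
    intro n
    by_cases hn : n < e
    · exact ⟨none, Or.inl ⟨hn, rfl⟩⟩
    · obtain ⟨k, r, hr, hk⟩ := exists_block (b := b) hpos (not_lt.1 hn)
      exact ⟨_, Or.inr ⟨k, r, hr, hk, rfl⟩⟩
  choose lab hlab using hex
  refine ⟨lab, hlab, ?_⟩
  have hlab_lt : ∀ n, n < e → lab n = none := by
    intro n hn
    rcases hlab n with h1 | ⟨k, r, hr, hk, _⟩
    · exact h1.2
    · have := le_blockStart (h := h) (b := b) (e := e) k
      omega
  have hlab_block : ∀ k r, r < h (b k) → lab (blockStart h b e k + r) = some (b k, r) := by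
    intro k r hr
    rcases hlab (blockStart h b e k + r) with h1 | ⟨k', r', hr', hk', hl⟩
    · have := le_blockStart (h := h) (b := b) (e := e) k
      omega
    · obtain ⟨rfl, rfl⟩ := block_unique hr hr' hk'
      exact hl
  have hnone : ∀ n, e ≤ n → lab n ≠ none := by
    intro n hn
    obtain ⟨k, r, hr, rfl⟩ := exists_block (b := b) hpos hn
    rw [hlab_block k r hr]
    simp
  have hmono : ∀ (c : Option (κ × ℕ)) {n n' : ℕ}, n ≤ n' →
      ∑ j ∈ Finset.range n, (if lab j = c then (1 : ℝ) else 0)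
        ≤ ∑ j ∈ Finset.range n', (if lab j = c then (1 : ℝ) else 0) := by
    intro c n n' hnn
    exact Finset.sum_le_sum_of_subset_of_nonneg (Finset.range_subset_range.2 hnn)
      fun _ _ _ => by split_ifs <;> norm_num
  have hle : ∀ (c : Option (κ × ℕ)) (n r : ℕ),
      ∑ j ∈ Finset.range (n + r), (if lab j = c then (1 : ℝ) else 0)
        ≤ ∑ j ∈ Finset.range n, (if lab j = c then (1 : ℝ) else 0) + r := by
    intro c n r
    rw [Finset.sum_range_add]
    have : ∑ i ∈ Finset.range r, (if lab (n + i) = c then (1 : ℝ) else 0)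
        ≤ ∑ i ∈ Finset.range r, 1 := Finset.sum_le_sum fun i _ => by split_ifs <;> norm_num
    simp only [Finset.sum_const, Finset.card_range, nsmul_eq_mul, mul_one] at this
    linarith
  have hS0 : 0 ≤ (∑ c, |f c|) * D := by positivity
  have hNe : (e : ℝ) ≤ N := by exact_mod_cast he
  intro c n
  rcases c with _ | ⟨c, s⟩
  · -- the dummy label
    have h1 : ∑ j ∈ Finset.range n, (if lab j = none then (1 : ℝ) else 0) ≤ e := by
      have h2 : ∑ j ∈ Finset.range (e + n), (if lab j = none then (1 : ℝ) else 0) ≤ e := by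
        rw [Finset.sum_range_add, Finset.sum_eq_zero (s := Finset.range n)
          fun i _ => if_neg (hnone _ (Nat.le_add_right _ _)), add_zero]
        have := hle none 0 e
        simpa using this
      exact (hmono none (Nat.le_add_left n e)).trans h2
    have h0 : 0 ≤ ∑ j ∈ Finset.range n, (if lab j = none then (1 : ℝ) else 0) :=
      Finset.sum_nonneg fun _ _ => by split_ifs <;> norm_num
    have hF0 : F none = 0 := rfl
    rw [hF0, mul_zero, sub_zero, abs_of_nonneg h0]
    have : (0 : ℝ) ≤ H := Nat.cast_nonneg _
    linarith [abs_nonneg C]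
  -- A complete block of type c contains each step s < h c exactly once.
  · have hblocks : ∀ k, ∑ j ∈ Finset.range (blockStart h b e k),
        (if lab j = some (c, s) then (1 : ℝ) else 0)
        = (∑ i ∈ Finset.range k, (if b i = c then (1 : ℝ) else 0)) *
          if s < h c then 1 else 0 := by
      intro k
      induction k with
      | zero =>
        rw [blockStart_zero]
        simp only [Finset.range_zero, Finset.sum_empty, zero_mul]
        exact Finset.sum_eq_zero fun j hj => by
          rw [hlab_lt j (Finset.mem_range.1 hj)]; simp
      | succ k ih =>
        rw [blockStart_succ, Finset.sum_range_add, ih, Finset.sum_range_succ, add_mul]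
        congr 1
        rw [Finset.sum_congr rfl fun i hi => by rw [hlab_block k i (Finset.mem_range.1 hi)]]
        by_cases hc : b k = c
        · subst hc
          simp [Finset.sum_ite_eq']
        · simp [hc]
    have hFc : F (some (c, s)) = if s < h c then f c / ℓ else 0 := rfl
    rw [hFc]
    rcases lt_or_ge n e with hn | hn
    · have h1 : ∑ j ∈ Finset.range n, (if lab j = some (c, s) then (1 : ℝ) else 0) = 0 :=
        Finset.sum_eq_zero fun j hj => by
          rw [hlab_lt j ((Finset.mem_range.1 hj).trans hn)]; simp
      rw [h1]
      have hfc : |f c| ≤ ∑ c, |f c| :=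
        Finset.single_le_sum (f := fun c => |f c|) (fun _ _ => abs_nonneg _) (Finset.mem_univ c)
      have hnD : (n : ℝ) ≤ D := by
        have h2 : (n : ℝ) ≤ N := by exact_mod_cast hn.le.trans he
        have h3 : 0 ≤ ∑ c : κ, |C| * h c := by positivity
        have : (0 : ℝ) ≤ H := Nat.cast_nonneg _
        linarith
      have h4 : |(0 : ℝ) - n * if s < h c then f c / ℓ else 0| ≤ (∑ c, |f c|) * D := by
        rw [zero_sub, abs_neg, abs_mul, Nat.abs_cast, mul_comm]
        refine mul_le_mul (le_trans ?_ hfc) hnD (Nat.cast_nonneg _) (by positivity)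
        split_ifs
        · rw [abs_div, abs_of_pos (by linarith : 0 < ℓ)]
          exact div_le_self (abs_nonneg _) hℓ1
        · simp
      have : (0 : ℝ) ≤ H := Nat.cast_nonneg _
      have : (0 : ℝ) ≤ N := Nat.cast_nonneg _
      linarith [abs_nonneg C]
    · obtain ⟨k, r, hr, rfl⟩ := exists_block (b := b) hpos hn
      have h1 := hmono (some (c, s)) (Nat.le_add_right (blockStart h b e k) r)
      have h2 := hle (some (c, s)) (blockStart h b e k) r
      rw [hblocks] at h1 h2
      have hrH : (r : ℝ) ≤ H := by exact_mod_cast hr.le.trans (hH _)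
      have hr0 : (0 : ℝ) ≤ r := Nat.cast_nonneg _
      have hfk := abs_le.1 (hC c k)
      have hfc : |f c| ≤ ∑ c, |f c| :=
        Finset.single_le_sum (f := fun c => |f c|) (fun _ _ => abs_nonneg _) (Finset.mem_univ c)
      have hN0 : (0 : ℝ) ≤ N := Nat.cast_nonneg _
      have hnk : |((blockStart h b e k + r : ℕ) : ℝ) - k * ℓ| ≤ D := by
        have h3 := abs_le.1 (hlin k)
        have he0 : (0 : ℝ) ≤ e := Nat.cast_nonneg _
        push_cast
        rw [abs_le]
        constructor <;> linarith
      split_ifs at h1 h2 ⊢ with hs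
      · rw [mul_one] at h1 h2
        have h4 : |k * f c - ((blockStart h b e k + r : ℕ) : ℝ) * (f c / ℓ)|
            ≤ (∑ c, |f c|) * D := by
          have h5 : k * f c - ((blockStart h b e k + r : ℕ) : ℝ) * (f c / ℓ)
              = -(f c / ℓ) * (((blockStart h b e k + r : ℕ) : ℝ) - k * ℓ) := by
            field_simp
            ring
          rw [h5, abs_mul, abs_neg, abs_div, abs_of_pos (by linarith : 0 < ℓ)]
          exact mul_le_mul ((div_le_self (abs_nonneg _) hℓ1).trans hfc) hnk (abs_nonneg _)
            (by positivity)
        have h5 := abs_le.1 h4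
        rw [abs_le]
        constructor <;> linarith
      · rw [mul_zero] at h1 h2
        have hn0 : ((blockStart h b e k + r : ℕ) : ℝ) * 0 = 0 := mul_zero _
        rw [hn0, sub_zero, abs_of_nonneg h1]
        linarith [abs_nonneg C]

end Suspension

/-! ### Orbits near the line y = 1, the lower strip and its basin -/

section Strip

variable {a b lam : ℝ}

/-- The margin in the inequality on `a`. -/
noncomputable def margin (a lam : ℝ) : ℝ := lam * (1 + lam - lam ^ 3 - lam ^ 4 - a) / 16

lemma margin_pos (h : Admissible a b lam) : 0 < margin a lam := by
  have := h.lam_pos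
  have := h.a_lt
  rw [margin]
  have : 0 < 1 + lam - lam ^ 3 - lam ^ 4 - a := by linarith
  positivity

lemma Admissible.lam_lt_one (h : Admissible a b lam) : lam < 1 := by
  linarith [h.b_pos, h.b_eq]

lemma margin_le (h : Admissible a b lam) : 8 * margin a lam ≤ lam := by
  have h1 := h.lam_pos
  have h2 := h.a_pos
  have h3 := h.lam_lt_one
  have h4 : 0 < lam ^ 3 := by positivity
  have h5 : 0 < lam ^ 4 := by positivity
  rw [margin]
  nlinarith

lemma margin_le' (h : Admissible a b lam) :
    16 * margin a lam ≤ 1 + lam - lam ^ 3 - lam ^ 4 - a := by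
  have h1 := h.lam_pos
  have h2 := h.a_lt
  have h3 := h.lam_lt_one
  rw [margin]
  nlinarith

/-- The rectangle just below the segment of length `lam * (1 + lam)` on the left of `A`, to which
the first return is considered. -/
def lowerStrip (a lam : ℝ) : Set (ℝ × ℝ) :=
  {p | -(lam * (1 + lam)) < p.1 ∧ p.1 < 0 ∧ -(lam ^ 3 * margin a lam) < p.2 - 1 ∧ p.2 < 1}

/-- A compact neighbourhood of the attractor. -/
def trap (a lam : ℝ) : Set (ℝ × ℝ) :=
  Set.Icc (-(lam * (1 + lam))) (1 + lam) ×ˢ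
    Set.Icc (1 - lam ^ 3 * margin a lam) (1 + lam ^ 3 * margin a lam) ∪
  Set.Icc 0 (lam * (lam * (1 + lam))) ×ˢ
    Set.Icc (-lam - lam ^ 3 * margin a lam) (-lam + lam ^ 3 * margin a lam)

/-- An open neighbourhood of `trap`. -/
def openTrap (a lam : ℝ) : Set (ℝ × ℝ) :=
  Set.Ioo (-(lam * (1 + lam)) - margin a lam) (1 + lam + margin a lam) ×ˢ
    Set.Ioo (1 - margin a lam) (1 + margin a lam) ∪
  Set.Ioo (-margin a lam) (lam * (lam * (1 + lam)) + margin a lam) ×ˢ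
    Set.Ioo (-lam - margin a lam) (-lam + margin a lam)

lemma step_D (h : Admissible a b lam) {u d : ℝ} (hu : u < 0) (hd : -1 < d) :
    outerMap (quad a b) lam (u, 1 + d) = (-lam * u, -lam - lam * d) := by
  rw [outerMap_D h ⟨hu, by have := mul_neg_of_pos_of_neg h.b_pos hu; simp only; linarith⟩]
  ext <;> simp; ring

lemma step_C (h : Admissible a b lam) {v d : ℝ} (h1 : -lam + d < b * v)
    (h2 : lam * (v - a) < (1 - a) * (1 + lam - d)) :
    outerMap (quad a b) lam (v, -lam + d) = (1 + lam - lam * v, 1 - lam * d) := by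
  rw [outerMap_C h ⟨h1, by simp only; linarith⟩]
  ext <;> simp; ring

lemma step_A (h : Admissible a b lam) {w d : ℝ} (hw : 0 < w) (hd : 0 < d) :
    outerMap (quad a b) lam (w, 1 + d) = (-lam * w, 1 - lam * d) := by
  rw [outerMap_A h ⟨hw, by simp only; linarith⟩]
  ext <;> simp; ring

lemma step_B (h : Admissible a b lam) {w d : ℝ} (hd : d < 0)
    (hw : (1 - a) * (-d) < lam * (w - a)) :
    outerMap (quad a b) lam (w, 1 + d) = ((1 + lam) * a - lam * w, 1 - lam * d) := by
  rw [outerMap_B h ⟨by simp only; linarith, by simp only; linarith⟩]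
  ext <;> simp; ring

lemma step_D_left (h : Admissible a b lam) {u d : ℝ} (hu : u < 0) (hd : |d| < 1) :
    outerMap (quad a b) lam (u, 1 + d) = (-lam * u, -lam - lam * d) :=
  step_D h hu (by linarith [(abs_lt.1 hd).1])

/-- The inequality `hud` says that the image under D lies on the side of the line BC seen from C.
The same inequality, multiplied by lam, later places the second iterate in the region of B when d <
0. -/
lemma step_DC (h : Admissible a b lam) {u d : ℝ} (hu : u < 0) (hd : |d| < 1)
    (hud : (1 - a) * lam * |d| < 1 + lam - a + lam ^ 2 * u) :
    (outerMap (quad a b) lam)^[2] (u, 1 + d) = (1 + lam + lam ^ 2 * u, 1 + lam ^ 2 * d) := by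
  have h4 := h.lam_pos
  have h3 := h.b_pos
  have hd1 := abs_lt.1 hd
  have hneg : (1 - a) * lam * (-d) ≤ (1 - a) * lam * |d| :=
    mul_le_mul_of_nonneg_left (neg_le_abs d) (mul_nonneg (by linarith [h.a_lt_one]) h4.le)
  rw [Function.iterate_succ_apply, Function.iterate_one, step_D_left h hu hd, sub_eq_add_neg,
    step_C h]
  · ext <;> simp <;> ring
  · have : 0 < lam * (1 + d) := mul_pos h4 (by linarith)
    have : 0 < b * (-lam * u) := by
      have := mul_pos h4 (neg_pos.2 hu)
      exact mul_pos h3 (by linarith)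
    linarith
  · nlinarith

variable {u d : ℝ}

/-- The third iterate of a point above the segment. -/
lemma iterate_three_upper (h : Admissible a b lam) (hu : u < 0) (hd0 : 0 < d) (hd : |d| < 1)
    (hud : (1 - a) * lam * |d| < 1 + lam - a + lam ^ 2 * u) :
    (outerMap (quad a b) lam)^[3] (u, 1 + d)
      = (-lam * (1 + lam) - lam ^ 3 * u, 1 - lam ^ 3 * d) := by
  have h4 := h.lam_pos
  have h0 : 0 ≤ (1 - a) * lam * |d| :=
    mul_nonneg (mul_nonneg (by linarith [h.a_lt_one]) h4.le) (abs_nonneg d)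
  rw [Function.iterate_succ_apply', step_DC h hu hd hud,
    step_A h (by linarith [h.a_pos]) (by positivity)]
  ext <;> simp <;> ring

/-- The third iterate of a point below the segment. -/
lemma iterate_three_lower (h : Admissible a b lam) (hu : u < 0) (hd0 : d < 0) (hd : |d| < 1)
    (hud : (1 - a) * lam * |d| < 1 + lam - a + lam ^ 2 * u) :
    (outerMap (quad a b) lam)^[3] (u, 1 + d)
      = ((1 + lam) * (a - lam) - lam ^ 3 * u, 1 - lam ^ 3 * d) := by
  have h4 := h.lam_pos
  rw [Function.iterate_succ_apply', step_DC h hu hd hud, step_B h]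
  · ext <;> simp <;> ring
  · have : 0 < lam ^ 2 * (-d) := mul_pos (by positivity) (by linarith)
    linarith
  · rw [abs_of_neg hd0] at hud
    have := mul_lt_mul_of_pos_left hud h4
    nlinarith

lemma fst_ne_zero (hp : (u, d) ∈ regularSet (quad a b) lam) (hd : 0 ≤ d) : u ≠ 0 := by
  rintro rfl
  exact notMem_singularRays hp (mem_singularRays_DA hd)

lemma snd_ne_one (h : Admissible a b lam) (hp : (u, d) ∈ regularSet (quad a b) lam) (hu : 0 ≤ u) :
    d ≠ 1 := by
  rintro rfl
  exact notMem_singularRays hp (mem_singularRays_AB h.a_pos hu)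

/-- The strip condition on points of the strip. -/
lemma strip_condition (h : Admissible a b lam) (hu : -(lam * (1 + lam)) - margin a lam < u)
    (hd : |d| < margin a lam) : |d| < 1 ∧ (1 - a) * lam * |d| < 1 + lam - a + lam ^ 2 * u := by
  have h1 := margin_le h
  have h2 := margin_le' h
  have h3 := h.lam_lt_one
  have h4 := h.lam_pos
  have h5 := margin_pos h
  refine ⟨by linarith, ?_⟩
  -- At the left end, lam^2 u is about -(lam^3 + lam^4), so the right side is at least the slack in
  -- the hypothesis on a, up to the margin. The slack is at least 16 margins.
  have e1 : (1 - a) * lam * |d| ≤ 1 * margin a lam :=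
    mul_le_mul (by nlinarith [h.a_pos, h.a_lt_one]) hd.le (abs_nonneg d) zero_le_one
  have e2 := mul_lt_mul_of_pos_left hu (by positivity : 0 < lam ^ 2)
  have e3 : lam ^ 2 * margin a lam ≤ 1 * margin a lam :=
    mul_le_mul_of_nonneg_right (by nlinarith) h5.le
  nlinarith

lemma abs_pow_mul_le (h : Admissible a b lam) (k : ℕ) (d : ℝ) : |lam ^ k * d| ≤ |d| := by
  rw [abs_mul, abs_of_pos (pow_pos h.lam_pos k)]
  exact mul_le_of_le_one_left (abs_nonneg d) (pow_le_one₀ h.lam_pos.le h.lam_lt_one.le)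

lemma iterate_three_mem_lowerStrip (h : Admissible a b lam) (hu : u < 0) (hd0 : 0 < d)
    (hd : |d| < margin a lam) (hud : (1 - a) * lam * |d| < 1 + lam - a + lam ^ 2 * u) :
    (outerMap (quad a b) lam)^[3] (u, 1 + d) ∈ lowerStrip a lam := by
  have h4 := h.lam_pos
  have hm := margin_le h
  have h3 := h.lam_lt_one
  rw [iterate_three_upper h hu hd0 (by linarith) hud]
  have hu3 : lam ^ 3 * u < 0 := mul_neg_of_pos_of_neg (by positivity) hu
  have h0 : 0 ≤ (1 - a) * lam * |d| :=
    mul_nonneg (mul_nonneg (by linarith [h.a_lt_one]) h4.le) (abs_nonneg d)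
  rw [abs_of_pos hd0] at hd
  have hd3 := mul_lt_mul_of_pos_left hd (by positivity : 0 < lam ^ 3)
  have hd3' : 0 < lam ^ 3 * d := by positivity
  refine ⟨?_, ?_, ?_, ?_⟩ <;> simp only
  · linarith
  · have : 0 < lam * (1 + lam + lam ^ 2 * u) := mul_pos h4 (by linarith [h.a_pos])
    linarith
  · linarith
  · linarith

/-- From above the line, three steps suffice. From below, the third iterate is above the line: if it
is right of A, one reflection in A finishes; if it is left of A, the case from above applies, for 6
steps in all. Points on the line itself are not regular, since their second iterate lies on the ray
AB. -/
lemma exists_iterate_mem_lowerStrip (h : Admissible a b lam)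
    (hp : (u, 1 + d) ∈ regularSet (quad a b) lam) (hu : u < 0)
    (hd : |d| < margin a lam) (hud : (1 - a) * lam * |d| < 1 + lam - a + lam ^ 2 * u) :
    ∃ e ≤ 6, (outerMap (quad a b) lam)^[e] (u, 1 + d) ∈ lowerStrip a lam := by
  have h4 := h.lam_pos
  have hm := margin_le h
  have hm0 := margin_pos h
  have h3 := h.lam_lt_one
  have hd1 : |d| < 1 := by linarith
  have h0 : 0 ≤ (1 - a) * lam * |d| :=
    mul_nonneg (mul_nonneg (by linarith [h.a_lt_one]) h4.le) (abs_nonneg d)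
  rcases lt_trichotomy d 0 with hd0 | rfl | hd0
  · have e3 := iterate_three_lower h hu hd0 hd1 hud
    have hreg := iterate_mem_regularSet h hp 3
    rw [e3] at hreg
    have hd3 : 0 < -(lam ^ 3 * d) := by
      have := mul_neg_of_pos_of_neg (by positivity : 0 < lam ^ 3) hd0
      linarith
    have hz0 : (1 + lam) * (a - lam) - lam ^ 3 * u ≠ 0 := fst_ne_zero hreg (by linarith)
    have hu3 : lam ^ 3 * u < 0 := mul_neg_of_pos_of_neg (by positivity) hu
    rcases hz0.lt_or_gt with hz | hz
    · refine ⟨3 + 3, le_rfl, ?_⟩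
      have e4 : |-(lam ^ 3 * d)| < margin a lam := by
        rw [abs_neg]; exact (abs_pow_mul_le h 3 d).trans_lt hd
      rw [Function.iterate_add_apply, e3, sub_eq_add_neg 1]
      refine iterate_three_mem_lowerStrip h hz hd3 e4 (strip_condition h ?_ e4).2
      nlinarith [h.a_pos]
    · refine ⟨4, by norm_num, ?_⟩
      rw [Function.iterate_succ_apply', e3, sub_eq_add_neg 1, step_A h hz hd3]
      rw [abs_of_neg hd0] at hd
      have hd3' := mul_lt_mul_of_pos_left hd (by positivity : 0 < lam ^ 3)
      have hl : lam * -(lam ^ 3 * d) ≤ -(lam ^ 3 * d) := by nlinarith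
      have hz' := mul_pos h4 hz
      refine ⟨?_, ?_, ?_, ?_⟩ <;> simp only
      · have hw : a < 1 + lam + lam ^ 2 * u := by linarith
        have := mul_lt_mul_of_pos_left hw h4
        have hza : (1 + lam) * (a - lam) - lam ^ 3 * u < 1 + lam := by
          nlinarith [h.a_lt_one]
        have := mul_lt_mul_of_pos_left hza h4
        linarith
      · linarith
      · linarith
      · have := mul_pos h4 hd3
        linarith
  · exfalso
    have hreg := iterate_mem_regularSet h hp 2
    rw [step_DC h hu hd1 hud] at hreg
    exact snd_ne_one h hreg (by linarith [h.a_pos]) (by ring)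
  · exact ⟨3, by norm_num, iterate_three_mem_lowerStrip h hu hd0 hd hud⟩

/-- The regular points which reach the lower strip within `N` steps. -/
def basin (a b lam : ℝ) (N : ℕ) : Set (ℝ × ℝ) :=
  {p | p ∈ regularSet (quad a b) lam ∧
    ∃ e ≤ N, (outerMap (quad a b) lam)^[e] p ∈ lowerStrip a lam}

lemma basin_mono {N N' : ℕ} (hN : N ≤ N') : basin a b lam N ⊆ basin a b lam N' :=
  fun _ ⟨hp, e, he, hq⟩ => ⟨hp, e, he.trans hN, hq⟩

lemma mem_basin_of_iterate {p : ℝ × ℝ} {N k : ℕ} (hp : p ∈ regularSet (quad a b) lam)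
    (hk : (outerMap (quad a b) lam)^[k] p ∈ basin a b lam N) : p ∈ basin a b lam (N + k) := by
  obtain ⟨_, e, he, hq⟩ := hk
  rw [← Function.iterate_add_apply] at hq
  exact ⟨hp, e + k, by omega, hq⟩

lemma mem_basin_of_strip (h : Admissible a b lam)
    (hp : (u, 1 + d) ∈ regularSet (quad a b) lam) (hu : u < 0)
    (hd : |d| < margin a lam) (hud : (1 - a) * lam * |d| < 1 + lam - a + lam ^ 2 * u) :
    (u, 1 + d) ∈ basin a b lam 6 :=
  ⟨hp, exists_iterate_mem_lowerStrip h hp hu hd hud⟩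

lemma mem_basin_of_step {p : ℝ × ℝ} {N : ℕ} (hp : p ∈ regularSet (quad a b) lam)
    (hk : outerMap (quad a b) lam p ∈ basin a b lam N) : p ∈ basin a b lam (N + 1) :=
  mem_basin_of_iterate (k := 1) hp hk

lemma mem_basin_of_right_upper (h : Admissible a b lam)
    (hp : (u, 1 + d) ∈ regularSet (quad a b) lam) (hu : 0 < u) (hu' : u < 1 + lam + margin a lam)
    (hd0 : 0 < d) (hd : |d| < margin a lam) : (u, 1 + d) ∈ basin a b lam 7 := by
  have h4 := h.lam_pos
  have h3 := h.lam_lt_one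
  have hm0 := margin_pos h
  have hreg := outerMap_mem_regularSet h hp
  refine mem_basin_of_step hp ?_
  rw [step_A h hu hd0, sub_eq_add_neg] at hreg ⊢
  have hd' : |-(lam * d)| < margin a lam := by
    have := abs_pow_mul_le h 1 d
    rw [pow_one] at this
    rw [abs_neg]
    linarith
  refine mem_basin_of_strip h hreg (by nlinarith) hd' (strip_condition h ?_ hd').2
  nlinarith

/-- Left of A the strip estimates apply directly. Right of A, a reflection in A leads to the left
side; a reflection in B leads above the line, on either side of A. -/
lemma mem_basin_of_mem_openTrap_fst (h : Admissible a b lam)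
    (hp : (u, 1 + d) ∈ regularSet (quad a b) lam) (hu : -(lam * (1 + lam)) - margin a lam < u)
    (hu' : u < 1 + lam + margin a lam) (hd : |d| < margin a lam) :
    (u, 1 + d) ∈ basin a b lam 8 := by
  have h4 := h.lam_pos
  have h3 := h.lam_lt_one
  have hm0 := margin_pos h
  have hm := margin_le h
  have hd1 := abs_lt.1 hd
  have hu0 := fst_ne_zero hp (by linarith)
  rcases hu0.lt_or_gt with hneg | hpos
  · exact basin_mono (by norm_num) (mem_basin_of_strip h hp hneg hd (strip_condition h hu hd).2)
  have hdne : d ≠ 0 := by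
    rintro rfl
    exact snd_ne_one h hp hpos.le (by ring)
  rcases hdne.lt_or_gt with hd0 | hd0
  swap
  · exact basin_mono (by norm_num) (mem_basin_of_right_upper h hp hpos hu' hd0 hd)
  have hB : (u, 1 + d) ∈ regionB a lam := by
    rcases mem_region h (notMem_polygon hp) (notMem_singularRays hp) with hr | hr | hr | hr
    · have := hr.2
      simp only at this
      linarith
    · exact hr
    -- The region of C is a cone below its apex C, which has height b = 1 - lam; eliminating u gives
    -- d < -lam, whereas |d| is at most lam / 8.
    · exfalso
      obtain ⟨e1, e2⟩ := hr
      simp only at e1 e2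
      have hb := h.b_pos
      have hbe := h.b_eq
      have ha := sub_pos.2 h.a_lt_one
      have h5 : lam * (1 + d) < lam * (b * u) := mul_lt_mul_of_pos_left e1 h4
      have h6 : b * (lam * (u - a)) < b * ((1 - a) * (1 - (1 + d))) :=
        mul_lt_mul_of_pos_left e2 hb
      have h7 : (lam + b * (1 - a)) * (-d) ≤ (lam + b * (1 - a)) * margin a lam :=
        mul_le_mul_of_nonneg_left (by linarith) (by positivity)
      have h8 : (lam + b * (1 - a)) * (8 * margin a lam) ≤ (lam + b * (1 - a)) * lam :=
        mul_le_mul_of_nonneg_left hm (by positivity)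
      have h9 : lam + b * (1 - a) = 1 - a * b := by rw [hbe]; ring
      have h10 : 0 < 1 - a * b := h9 ▸ by positivity
      rw [h9] at h7 h8
      nlinarith
    · have := hr.1
      simp only at this
      linarith
  have hBw := hB.2
  simp only at hBw
  have hua : a < u := by
    have h5 : 0 < (1 - a) * (1 - (1 + d)) := mul_pos (sub_pos.2 h.a_lt_one) (by linarith)
    have := pos_of_mul_pos_right (h5.trans hBw) h4.le
    linarith
  have hreg := outerMap_mem_regularSet h hp
  refine mem_basin_of_step hp ?_
  rw [step_B h hd0 (by linarith), sub_eq_add_neg 1] at hreg ⊢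
  have hd0' : 0 < -(lam * d) := by
    have := mul_neg_of_pos_of_neg h4 hd0
    linarith
  have hd' : |-(lam * d)| < margin a lam := by
    have := abs_pow_mul_le h 1 d
    rw [pow_one] at this
    rw [abs_neg]
    linarith
  have hz0 := fst_ne_zero hreg (by linarith)
  have hau := mul_lt_mul_of_pos_left hua h4
  rcases hz0.lt_or_gt with hz | hz
  · refine basin_mono (by norm_num) (mem_basin_of_strip h hreg hz hd' (strip_condition h ?_ hd').2)
    nlinarith [h.a_pos]
  · exact mem_basin_of_right_upper h hreg hz (by nlinarith [h.a_lt_one]) hd0' hd'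

lemma mem_basin_of_mem_openTrap (h : Admissible a b lam) {p : ℝ × ℝ}
    (hp : p ∈ regularSet (quad a b) lam) (hO : p ∈ openTrap a lam) : p ∈ basin a b lam 9 := by
  obtain ⟨x, y⟩ := p
  have h4 := h.lam_pos
  have h3 := h.lam_lt_one
  have hm0 := margin_pos h
  have hm := margin_le h
  have hm' := margin_le' h
  have ha := h.a_pos
  rcases hO with ⟨⟨h1, h2⟩, h5, h6⟩ | ⟨⟨h1, h2⟩, h5, h6⟩ <;> simp only at h1 h2 h5 h6
  · obtain ⟨d, rfl⟩ : ∃ d, y = 1 + d := ⟨y - 1, by ring⟩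
    exact basin_mono (by norm_num)
      (mem_basin_of_mem_openTrap_fst h hp h1 h2 (abs_lt.2 ⟨by linarith, by linarith⟩))
  · obtain ⟨d, rfl⟩ : ∃ d, y = -lam + d := ⟨y + lam, by ring⟩
    have hreg := outerMap_mem_regularSet h hp
    refine mem_basin_of_step hp ?_
    have hd : |d| < margin a lam := abs_lt.2 ⟨by linarith, by linarith⟩
    have hx1 := mul_lt_mul_of_pos_left h1 h.b_pos
    have hx2 := mul_lt_mul_of_pos_left h1 h4
    have hx3 := mul_lt_mul_of_pos_left h2 h4
    have hbm : b * margin a lam ≤ margin a lam := by nlinarith [h.b_eq]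
    have hlm : lam * margin a lam ≤ margin a lam := by nlinarith
    rw [step_C h (by linarith) (by nlinarith), sub_eq_add_neg 1] at hreg ⊢
    refine mem_basin_of_mem_openTrap_fst h hreg ?_ (by linarith) ?_
    · have : lam * (lam * (lam * (1 + lam))) = lam ^ 3 + lam ^ 4 := by ring
      nlinarith
    · have := abs_pow_mul_le h 1 d
      rw [pow_one] at this
      rw [abs_neg]
      linarith

end Strip

/-! ### The return map to the lower strip as a contracted rotation -/

section Return

variable {a b lam : ℝ}

/-- The number of steps in which a point of the lower strip returns to the lower strip. -/
noncomputable def returnTime (a lam : ℝ) (p : ℝ × ℝ) : ℕ :=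
  if lam ^ 3 * p.1 < (1 + lam) * (a - lam) then 4 else 6

lemma one_le_returnTime (p : ℝ × ℝ) : 1 ≤ returnTime a lam p := by
  rw [returnTime]; split_ifs <;> norm_num

lemma lowerStrip_condition (h : Admissible a b lam) {u d : ℝ}
    (hq : (u, 1 + d) ∈ lowerStrip a lam) :
    u < 0 ∧ d < 0 ∧ |d| < lam ^ 3 * margin a lam ∧ |d| < margin a lam ∧ |d| < 1 ∧
      (1 - a) * lam * |d| < 1 + lam - a + lam ^ 2 * u := by
  obtain ⟨h1, h2, h3, h4⟩ := hq
  simp only at h1 h2 h3 h4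
  have hm := margin_pos h
  have hl : lam ^ 3 * margin a lam ≤ 1 * margin a lam :=
    mul_le_mul_of_nonneg_right (pow_le_one₀ h.lam_pos.le h.lam_lt_one.le) hm.le
  have hd : |d| < lam ^ 3 * margin a lam := abs_lt.2 ⟨by linarith, by linarith⟩
  have hd' : |d| < margin a lam := by linarith
  have hs := strip_condition h (u := u) (by linarith) hd'
  exact ⟨h2, by linarith, hd, hd', hs.1, hs.2⟩

/-- The successive images of a point of the lower strip on the short branch. -/
lemma iterate_short (h : Admissible a b lam) {u d : ℝ} (hq : (u, 1 + d) ∈ lowerStrip a lam)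
    (hz : lam ^ 3 * u < (1 + lam) * (a - lam)) :
    outerMap (quad a b) lam (u, 1 + d) = (-lam * u, -lam - lam * d) ∧
    (outerMap (quad a b) lam)^[2] (u, 1 + d) = (1 + lam + lam ^ 2 * u, 1 + lam ^ 2 * d) ∧
    (outerMap (quad a b) lam)^[3] (u, 1 + d)
      = ((1 + lam) * (a - lam) - lam ^ 3 * u, 1 - lam ^ 3 * d) ∧
    (outerMap (quad a b) lam)^[4] (u, 1 + d)
      = (-lam * (1 + lam) * (a - lam) + lam ^ 4 * u, 1 + lam ^ 4 * d) := by
  obtain ⟨hu, hd0, -, -, hd1, hud⟩ := lowerStrip_condition h hq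
  have e3 := iterate_three_lower h hu hd0 hd1 hud
  refine ⟨step_D_left h hu hd1, step_DC h hu hd1 hud, e3, ?_⟩
  have hl : 0 < lam ^ 3 := pow_pos h.lam_pos 3
  rw [Function.iterate_succ_apply', e3, sub_eq_add_neg 1, step_A h (by linarith) (by nlinarith)]
  ext <;> simp <;> ring

/-- The successive images of a point of the lower strip on the long branch. -/
lemma iterate_long (h : Admissible a b lam) {u d : ℝ} (hq : (u, 1 + d) ∈ lowerStrip a lam)
    (hz : (1 + lam) * (a - lam) < lam ^ 3 * u) :
    outerMap (quad a b) lam (u, 1 + d) = (-lam * u, -lam - lam * d) ∧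
    (outerMap (quad a b) lam)^[2] (u, 1 + d) = (1 + lam + lam ^ 2 * u, 1 + lam ^ 2 * d) ∧
    (outerMap (quad a b) lam)^[3] (u, 1 + d)
      = ((1 + lam) * (a - lam) - lam ^ 3 * u, 1 - lam ^ 3 * d) ∧
    (outerMap (quad a b) lam)^[4] (u, 1 + d)
      = (-lam * (1 + lam) * (a - lam) + lam ^ 4 * u, -lam + lam ^ 4 * d) ∧
    (outerMap (quad a b) lam)^[5] (u, 1 + d)
      = (1 + lam + lam ^ 2 * (1 + lam) * (a - lam) - lam ^ 5 * u, 1 - lam ^ 5 * d) ∧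
    (outerMap (quad a b) lam)^[6] (u, 1 + d)
      = (-lam * (1 + lam) - lam ^ 3 * (1 + lam) * (a - lam) + lam ^ 6 * u, 1 + lam ^ 6 * d) := by
  obtain ⟨hu, hd0, -, hdm, hd1, hud⟩ := lowerStrip_condition h hq
  have hl : 0 < lam ^ 3 := pow_pos h.lam_pos 3
  have hl' := h.lam_pos
  have hm := margin_pos h
  have e3 := iterate_three_lower h hu hd0 hd1 hud
  have hd' : |-(lam ^ 3 * d)| < margin a lam := by
    rw [abs_neg]; exact (abs_pow_mul_le h 3 d).trans_lt hdm
  have hd0' : 0 < -(lam ^ 3 * d) := by nlinarith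
  have hz0 : (1 + lam) * (a - lam) - lam ^ 3 * u < 0 := by linarith
  obtain ⟨hd1', hud'⟩ := strip_condition h
    (u := (1 + lam) * (a - lam) - lam ^ 3 * u) (by nlinarith [h.a_pos]) hd'
  refine ⟨step_D_left h hu hd1, step_DC h hu hd1 hud, e3, ?_, ?_, ?_⟩
  · rw [Function.iterate_succ_apply', e3, sub_eq_add_neg 1, step_D_left h hz0 hd1']
    ext <;> simp <;> ring
  · rw [Function.iterate_add_apply _ 2 3, e3, sub_eq_add_neg 1, step_DC h hz0 hd1' hud']
    ext <;> simp <;> ring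
  · rw [Function.iterate_add_apply _ 3 3, e3, sub_eq_add_neg 1,
      iterate_three_upper h hz0 hd0' hd1' hud']
    ext <;> simp <;> ring

/-- Equality would put the third iterate on the ray from D through A. -/
lemma branch_ne (h : Admissible a b lam) {u d : ℝ} (hq : (u, 1 + d) ∈ lowerStrip a lam)
    (hp : (u, 1 + d) ∈ regularSet (quad a b) lam) :
    lam ^ 3 * u ≠ (1 + lam) * (a - lam) := by
  intro he
  obtain ⟨hu, hd0, -, -, hd1, hud⟩ := lowerStrip_condition h hq
  have hreg := iterate_mem_regularSet h hp 3
  rw [iterate_three_lower h hu hd0 hd1 hud] at hreg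
  have hl : 0 < lam ^ 3 := pow_pos h.lam_pos 3
  exact fst_ne_zero hreg (by nlinarith) (by linarith)

/-- The coordinate on the circle of a point of the lower strip. -/
noncomputable def angle (lam : ℝ) (p : ℝ × ℝ) : ℝ := 1 + p.1 / (lam * (1 + lam))

/-- The preimage of the discontinuity. -/
noncomputable def breakPoint (a lam : ℝ) : ℝ := 1 + (a - lam) / lam ^ 4

/-- The return map in the circle coordinate, on the fundamental domain. -/
noncomputable def returnBranch (a lam t : ℝ) : ℝ :=
  1 + (if t < breakPoint a lam then lam ^ 4 else lam ^ 6) * (t - breakPoint a lam)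

lemma breakPoint_le_one (h : Admissible a b lam) : breakPoint a lam ≤ 1 := by
  have := div_nonpos_of_nonpos_of_nonneg (sub_nonpos.2 h.a_le) (pow_pos h.lam_pos 4).le
  rw [breakPoint]
  linarith

lemma pow_six_le (h : Admissible a b lam) : lam ^ 6 ≤ lam ^ 4 :=
  pow_le_pow_of_le_one h.lam_pos.le h.lam_lt_one.le (by norm_num)

lemma pow_lt_one (h : Admissible a b lam) : lam ^ 4 < 1 :=
  pow_lt_one₀ h.lam_pos.le h.lam_lt_one (by norm_num)

lemma returnBranch_strictMono (h : Admissible a b lam) : StrictMono (returnBranch a lam) := by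
  intro s t hst
  have h4 : 0 < lam ^ 4 := pow_pos h.lam_pos 4
  have h6 : 0 < lam ^ 6 := pow_pos h.lam_pos 6
  simp only [returnBranch]
  split_ifs with h1 h2 h2 <;> nlinarith

/-- Both slopes are at most lam^4 < 1, so the image of the unit interval is shorter than one. Hence
the periodic extension jumps upwards at integers and stays increasing. -/
lemma returnBranch_lt (h : Admissible a b lam) {t : ℝ} (ht1 : t < 1) :
    returnBranch a lam t < 1 + returnBranch a lam 0 := by
  have h4 : 0 < lam ^ 4 := pow_pos h.lam_pos 4
  have h6 : 0 < lam ^ 6 := pow_pos h.lam_pos 6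
  have h64 := pow_six_le h
  have hlt := pow_lt_one h
  have hb := breakPoint_le_one h
  simp only [returnBranch]
  split_ifs with h1 h2 h2 <;> nlinarith

/-- The lift to the line of the return map of the circle. -/
noncomputable def returnLift (h : Admissible a b lam) : CircleDeg1Lift where
  toFun x := ⌊x⌋ + returnBranch a lam (Int.fract x)
  monotone' := by
    intro x y hxy
    rcases (Int.floor_mono hxy).eq_or_lt with he | hlt
    · have : Int.fract x ≤ Int.fract y := by
        rw [Int.fract, Int.fract, he]; linarith
      have := (returnBranch_strictMono h).monotone this
      simp only [he]
      linarith
    · have h1 := returnBranch_lt h (Int.fract_lt_one x)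
      have h2 := (returnBranch_strictMono h).monotone (Int.fract_nonneg y)
      have h3 : (⌊x⌋ : ℝ) + 1 ≤ ⌊y⌋ := by exact_mod_cast hlt
      simp only
      linarith
  map_add_one' x := by
    simp only [Int.floor_add_one, Int.fract_add_one]
    push_cast
    ring

lemma returnLift_apply (h : Admissible a b lam) (x : ℝ) :
    returnLift h x = ⌊x⌋ + returnBranch a lam (Int.fract x) := rfl

lemma returnLift_strictMono (h : Admissible a b lam) : StrictMono (returnLift h) := by
  intro x y hxy
  rw [returnLift_apply, returnLift_apply]
  rcases (Int.floor_mono hxy.le).eq_or_lt with he | hlt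
  · have : Int.fract x < Int.fract y := by
      rw [Int.fract, Int.fract, he]; linarith
    have := returnBranch_strictMono h this
    rw [he]
    linarith
  · have h1 := returnBranch_lt h (Int.fract_lt_one x)
    have h2 := (returnBranch_strictMono h).monotone (Int.fract_nonneg y)
    have h3 : (⌊x⌋ : ℝ) + 1 ≤ ⌊y⌋ := by exact_mod_cast hlt
    linarith

lemma angle_mem (h : Admissible a b lam) {p : ℝ × ℝ} (hq : p ∈ lowerStrip a lam) :
    0 < angle lam p ∧ angle lam p < 1 := by
  have hL : 0 < lam * (1 + lam) := mul_pos h.lam_pos (by linarith [h.lam_pos])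
  have h1 : -1 < p.1 / (lam * (1 + lam)) := by
    rw [lt_div_iff₀ hL]; linarith [hq.1]
  have h2 : p.1 / (lam * (1 + lam)) < 0 := div_neg_of_neg_of_pos hq.2.1 hL
  simp only [angle]
  constructor <;> linarith

lemma angle_lt_breakPoint_iff (h : Admissible a b lam) (p : ℝ × ℝ) :
    angle lam p < breakPoint a lam ↔ lam ^ 3 * p.1 < (1 + lam) * (a - lam) := by
  have h1 := h.lam_pos
  have h2 : 0 < 1 + lam := by linarith
  rw [angle, breakPoint, add_lt_add_iff_left, div_lt_div_iff₀ (by positivity) (by positivity)]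
  have : lam * (lam ^ 3 * p.1) < lam * ((1 + lam) * (a - lam)) ↔
      lam ^ 3 * p.1 < (1 + lam) * (a - lam) := mul_lt_mul_iff_right₀ h1
  rw [← this]
  constructor <;> intro h <;> linarith

/-- On the lower strip, the return map is given by the lift. -/
theorem return_spec (h : Admissible a b lam) {p : ℝ × ℝ} (hq : p ∈ lowerStrip a lam)
    (hp : p ∈ regularSet (quad a b) lam) :
    (outerMap (quad a b) lam)^[returnTime a lam p] p ∈ lowerStrip a lam ∧
    angle lam ((outerMap (quad a b) lam)^[returnTime a lam p] p)
      = Int.fract (returnLift h (angle lam p)) ∧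
    (if ⌊returnLift h (angle lam p)⌋ = 0 then 4 else 6) = returnTime a lam p := by
  obtain ⟨u, y⟩ := p
  obtain ⟨d, rfl⟩ : ∃ d, y = 1 + d := ⟨y - 1, by ring⟩
  have hang := angle_mem h hq
  have hl := h.lam_pos
  have hm := margin_pos h
  have hlift : returnLift h (angle lam (u, 1 + d)) = returnBranch a lam (angle lam (u, 1 + d)) := by
    rw [returnLift_apply, Int.floor_eq_zero_iff.2 ⟨hang.1.le, hang.2⟩,
      Int.fract_eq_self.2 ⟨hang.1.le, hang.2⟩]
    simp
  obtain ⟨hu, hd0, hd, -, -, -⟩ := lowerStrip_condition h hq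
  have h4 : 0 < lam ^ 4 := by positivity
  have h6 : 0 < lam ^ 6 := by positivity
  have h64 := pow_six_le h
  have h41 := pow_lt_one h
  have hbp := breakPoint_le_one h
  have hL : 0 < lam * (1 + lam) := mul_pos hl (by linarith)
  have hq1 := hq.1
  simp only at hq1
  have hne := branch_ne h hq hp
  rw [abs_of_neg hd0] at hd
  have hd3 : 0 < lam ^ 3 * margin a lam := by positivity
  have hl0 : lam ≠ 0 := hl.ne'
  have hl1 : 1 + lam ≠ 0 := by linarith
  rcases hne.lt_or_gt with hz | hz
  · have hrt : returnTime a lam (u, 1 + d) = 4 := if_pos hz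
    have hbr := (angle_lt_breakPoint_iff h (u, 1 + d)).2 hz
    rw [hrt, hlift, (iterate_short h hq hz).2.2.2]
    rw [returnBranch, if_pos hbr]
    -- On the long branch the lift lies strictly between 1 and 2, on the short branch in [0, 1):
    -- crossing an integer identifies the branch.
    have hfloor : ⌊1 + lam ^ 4 * (angle lam (u, 1 + d) - breakPoint a lam)⌋ = 0 := by
      rw [Int.floor_eq_zero_iff]
      constructor <;> nlinarith [hang.1]
    refine ⟨⟨?_, ?_, ?_, ?_⟩, ?_, by rw [if_pos hfloor]⟩
    · simp only
      have e1 : lam ^ 4 * u + lam * (1 + lam) > 0 := by nlinarith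
      nlinarith [mul_nonneg hL.le (sub_nonneg.2 h.a_le)]
    · simp only
      nlinarith [mul_lt_mul_of_pos_left hz hl]
    · simp only; nlinarith
    · simp only; nlinarith
    · rw [Int.fract, hfloor, angle, angle, breakPoint]
      field_simp
      ring
  · have hrt : returnTime a lam (u, 1 + d) = 6 := if_neg (by simp only; linarith)
    have hbr : ¬ angle lam (u, 1 + d) < breakPoint a lam := by
      rw [angle_lt_breakPoint_iff h]; simp only; linarith
    have hbr' : breakPoint a lam < angle lam (u, 1 + d) := by
      refine lt_of_le_of_ne (not_lt.1 hbr) ?_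
      intro he
      apply hne
      simp only [breakPoint, angle, add_right_inj] at he
      rw [div_eq_div_iff (by positivity) hL.ne'] at he
      have : lam * (lam ^ 3 * u) = lam * ((1 + lam) * (a - lam)) := by linarith
      exact mul_left_cancel₀ hl0 this
    rw [hrt, hlift, (iterate_long h hq hz).2.2.2.2.2]
    rw [returnBranch, if_neg hbr]
    have e1 : lam ^ 6 * (angle lam (u, 1 + d) - breakPoint a lam) < 1 := by
      have : lam ^ 6 * (1 - breakPoint a lam) = lam ^ 2 * (lam - a) := by
        rw [breakPoint]; field_simp; ring
      have e2 : lam ^ 6 * (angle lam (u, 1 + d) - breakPoint a lam)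
          < lam ^ 6 * (1 - breakPoint a lam) := by
        apply mul_lt_mul_of_pos_left _ h6
        linarith [hang.2]
      have e3 : lam ^ 2 * (lam - a) ≤ 1 * 1 :=
        mul_le_mul (pow_le_one₀ hl.le h.lam_lt_one.le) (by linarith [h.a_pos, h.lam_lt_one])
          (by linarith [h.a_le]) zero_le_one
      linarith
    have e0 : 0 < lam ^ 6 * (angle lam (u, 1 + d) - breakPoint a lam) :=
      mul_pos h6 (sub_pos.2 hbr')
    have hfloor : ⌊1 + lam ^ 6 * (angle lam (u, 1 + d) - breakPoint a lam)⌋ = 1 := by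
      rw [Int.floor_eq_iff]
      push_cast
      constructor <;> linarith
    have hl3 : 0 < lam ^ 3 := by positivity
    have hz3 := mul_lt_mul_of_pos_left hz hl3
    refine ⟨⟨?_, ?_, ?_, ?_⟩, ?_, ?_⟩
    · simp only
      nlinarith
    · simp only
      have e5 : lam ^ 6 * u < 0 := mul_neg_of_pos_of_neg h6 hu
      have e6 : lam ^ 3 * (lam - a) < lam := by
        have h3 : lam ^ 3 < 1 := pow_lt_one₀ hl.le h.lam_lt_one (by norm_num)
        nlinarith [h.a_pos, h.a_le]
      nlinarith [mul_lt_mul_of_pos_left e6 (by linarith : 0 < 1 + lam)]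
    · simp only; nlinarith
    · simp only; nlinarith
    · rw [Int.fract, hfloor, angle, angle, breakPoint]
      push_cast
      field_simp
      ring
    · rw [hfloor]; norm_num

/-- Two points of the lower strip on the same branch approach each other. -/
lemma dist_iterate_of_returnTime_eq (h : Admissible a b lam) {p q : ℝ × ℝ}
    (hp : p ∈ lowerStrip a lam) (hq : q ∈ lowerStrip a lam)
    (hpr : p ∈ regularSet (quad a b) lam) (hqr : q ∈ regularSet (quad a b) lam)
    (hpq : returnTime a lam p = returnTime a lam q) {j : ℕ} (hj : j ≤ returnTime a lam p) :
    dist ((outerMap (quad a b) lam)^[j] p) ((outerMap (quad a b) lam)^[j] q)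
      = lam ^ j * dist p q := by
  -- Points on the same branch are reflected in the same vertices, so their difference is multiplied
  -- by -lam at every step.
  have key : (outerMap (quad a b) lam)^[j] p - (outerMap (quad a b) lam)^[j] q
      = (-lam) ^ j • (p - q) := by
    obtain ⟨u, y⟩ := p
    obtain ⟨d, rfl⟩ : ∃ d, y = 1 + d := ⟨y - 1, by ring⟩
    obtain ⟨u', y'⟩ := q
    obtain ⟨d', rfl⟩ : ∃ d, y' = 1 + d := ⟨y' - 1, by ring⟩
    by_cases hz : lam ^ 3 * u < (1 + lam) * (a - lam)
    · have h1 : returnTime a lam (u, 1 + d) = 4 := if_pos hz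
      have hz' : lam ^ 3 * u' < (1 + lam) * (a - lam) := by
        by_contra hc
        have : returnTime a lam (u', 1 + d') = 6 := if_neg hc
        omega
      obtain ⟨e1, e2, e3, e4⟩ := iterate_short h hp hz
      obtain ⟨f1, f2, f3, f4⟩ := iterate_short h hq hz'
      rw [h1] at hj
      interval_cases j
      · simp
      · rw [Function.iterate_one, e1, f1]; ext <;> simp <;> ring
      · rw [e2, f2]; ext <;> simp <;> ring
      · rw [e3, f3]; ext <;> simp <;> ring
      · rw [e4, f4]; ext <;> simp <;> ring
    · have h1 : returnTime a lam (u, 1 + d) = 6 := if_neg hz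
      have hz' : ¬ lam ^ 3 * u' < (1 + lam) * (a - lam) := by
        intro hc
        have : returnTime a lam (u', 1 + d') = 4 := if_pos hc
        omega
      obtain ⟨e1, e2, e3, e4, e5, e6⟩ := iterate_long h hp
        (lt_of_le_of_ne (not_lt.1 hz) (branch_ne h hp hpr).symm)
      obtain ⟨f1, f2, f3, f4, f5, f6⟩ := iterate_long h hq
        (lt_of_le_of_ne (not_lt.1 hz') (branch_ne h hq hqr).symm)
      rw [h1] at hj
      interval_cases j
      · simp
      · rw [Function.iterate_one, e1, f1]; ext <;> simp <;> ring
      · rw [e2, f2]; ext <;> simp <;> ring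
      · rw [e3, f3]; ext <;> simp <;> ring
      · rw [e4, f4]; ext <;> simp <;> ring
      · rw [e5, f5]; ext <;> simp <;> ring
      · rw [e6, f6]; ext <;> simp <;> ring
  rw [dist_eq_norm, key, norm_smul, norm_pow, norm_neg, Real.norm_of_nonneg h.lam_pos.le,
    dist_eq_norm]

lemma mem_trap_of_mem_lowerStrip (h : Admissible a b lam) {p : ℝ × ℝ}
    (hp : p ∈ lowerStrip a lam) (hpr : p ∈ regularSet (quad a b) lam) {j : ℕ}
    (hj : j < returnTime a lam p) : (outerMap (quad a b) lam)^[j] p ∈ trap a lam := by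
  obtain ⟨u, y⟩ := p
  obtain ⟨d, rfl⟩ : ∃ d, y = 1 + d := ⟨y - 1, by ring⟩
  obtain ⟨hu, hd0, hd, -, hd1, hud⟩ := lowerStrip_condition h hp
  have hl := h.lam_pos
  have hl1 := h.lam_lt_one
  have ha := h.a_pos
  have hm := margin_pos h
  have hq1 := hp.1
  simp only at hq1
  have hdk : ∀ k, |lam ^ k * d| < lam ^ 3 * margin a lam := fun k =>
    (abs_pow_mul_le h k d).trans_lt hd
  have k0 := abs_lt.1 hd
  have k1 := abs_lt.1 (hdk 1)
  have k2 := abs_lt.1 (hdk 2)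
  have k3 := abs_lt.1 (hdk 3)
  have k4 := abs_lt.1 (hdk 4)
  have k5 := abs_lt.1 (hdk 5)
  rw [pow_one] at k1
  have hlu : -(lam * (lam * (1 + lam))) < lam * u := by
    have := mul_lt_mul_of_pos_left hq1 hl
    linarith
  have hlu0 : lam * u < 0 := mul_neg_of_pos_of_neg hl hu
  have hl2u : lam ^ 2 * u < 0 := mul_neg_of_pos_of_neg (by positivity) hu
  have h0 : 0 ≤ (1 - a) * lam * |d| :=
    mul_nonneg (mul_nonneg (by linarith [h.a_lt_one]) hl.le) (abs_nonneg d)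
  have hw := h0.trans_lt hud
  have hwl := mul_pos hl hw
  have hL : 0 < lam * (1 + lam) := by positivity
  have hal := h.a_le
  have hz3 : lam ^ 3 * u < 0 := mul_neg_of_pos_of_neg (by positivity) hu
  have t0 : (u, 1 + d) ∈ trap a lam :=
    Or.inl ⟨⟨hq1.le, by simp only; linarith⟩, ⟨by simp only; linarith, by simp only; linarith⟩⟩
  have t1 : (-lam * u, -lam - lam * d) ∈ trap a lam :=
    Or.inr ⟨⟨by simp only; linarith, by simp only; linarith⟩,
      ⟨by simp only; linarith, by simp only; linarith⟩⟩
  have t2 : (1 + lam + lam ^ 2 * u, 1 + lam ^ 2 * d) ∈ trap a lam :=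
    Or.inl ⟨⟨by simp only; linarith, by simp only; linarith⟩,
      ⟨by simp only; linarith, by simp only; linarith⟩⟩
  have t3 : ((1 + lam) * (a - lam) - lam ^ 3 * u, 1 - lam ^ 3 * d) ∈ trap a lam :=
    Or.inl ⟨⟨by simp only; nlinarith, by simp only; nlinarith⟩,
      ⟨by simp only; linarith, by simp only; linarith⟩⟩
  by_cases hz : lam ^ 3 * u < (1 + lam) * (a - lam)
  · have h1 : returnTime a lam (u, 1 + d) = 4 := if_pos hz
    obtain ⟨e1, e2, e3, -⟩ := iterate_short h hp hz
    rw [h1] at hj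
    interval_cases j
    · exact t0
    · rw [Function.iterate_one, e1]; exact t1
    · rw [e2]; exact t2
    · rw [e3]; exact t3
  · have h1 : returnTime a lam (u, 1 + d) = 6 := if_neg hz
    have hz' := lt_of_le_of_ne (not_lt.1 hz) (branch_ne h hp hpr).symm
    obtain ⟨e1, e2, e3, e4, e5, -⟩ := iterate_long h hp hz'
    have hzl := mul_lt_mul_of_pos_left hz' hl
    have hzl2 := mul_lt_mul_of_pos_left hz' (by positivity : 0 < lam ^ 2)
    have hzn : -(lam * (1 + lam)) ≤ (1 + lam) * (a - lam) - lam ^ 3 * u := by nlinarith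
    have hznl := mul_le_mul_of_nonneg_left hzn hl.le
    have hznl2 := mul_le_mul_of_nonneg_left hzn (by positivity : 0 ≤ lam ^ 2)
    rw [h1] at hj
    interval_cases j
    · exact t0
    · rw [Function.iterate_one, e1]; exact t1
    · rw [e2]; exact t2
    · rw [e3]; exact t3
    · rw [e4]
      exact Or.inr ⟨⟨by simp only; linarith, by simp only; linarith⟩,
        ⟨by simp only; linarith, by simp only; linarith⟩⟩
    · rw [e5]
      refine Or.inl ⟨⟨by simp only; nlinarith [h.a_lt], by simp only; linarith⟩,
        ⟨by simp only; linarith, by simp only; linarith⟩⟩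

end Return

/-! ### Uniform label frequencies along the orbits of the basin -/

open Classical in
/-- At every precision, the orbits of the points of `W` are described by finitely many labels, each
of which appears at a rate that does not depend on the orbit. -/
def HasUniformLabels {E : Type*} [PseudoMetricSpace E] (T : E → E) (W : Set E) : Prop :=
  ∀ ε > 0, ∃ (ι : Type) (S : Finset ι) (lab : E → ℕ → ι) (F : ι → ℝ) (C : ℝ) (n₀ : ℕ),
    (∀ x ∈ W, ∀ n, lab x n ∈ S) ∧
    (∀ x ∈ W, ∀ c n, |∑ j ∈ Finset.range n, (if lab x j = c then (1 : ℝ) else 0) - n * F c| ≤ C) ∧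
    ∀ x ∈ W, ∀ y ∈ W, ∀ m ≥ n₀, ∀ n ≥ n₀, lab x m = lab y n → dist (T^[m] x) (T^[n] y) < ε

section Labels

variable {a b lam : ℝ}

/-- The successive returns to the lower strip. -/
noncomputable def returnSeq (a b lam : ℝ) (p : ℝ × ℝ) : ℕ → ℝ × ℝ
  | 0 => p
  | k + 1 => (outerMap (quad a b) lam)^[returnTime a lam (returnSeq a b lam p k)]
      (returnSeq a b lam p k)

lemma returnSeq_mem (h : Admissible a b lam) {p : ℝ × ℝ} (hp : p ∈ lowerStrip a lam)
    (hpr : p ∈ regularSet (quad a b) lam) (k : ℕ) :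
    returnSeq a b lam p k ∈ lowerStrip a lam ∧
      returnSeq a b lam p k ∈ regularSet (quad a b) lam := by
  induction k with
  | zero => exact ⟨hp, hpr⟩
  | succ k ih => exact ⟨(return_spec h ih.1 ih.2).1, iterate_mem_regularSet h ih.2 _⟩

/-- The lift commutes with integer translations, so `return_spec`, which concerns the fundamental
domain, can be applied at the fractional part after each return. -/
lemma angle_returnSeq (h : Admissible a b lam) {p : ℝ × ℝ} (hp : p ∈ lowerStrip a lam)
    (hpr : p ∈ regularSet (quad a b) lam) (k : ℕ) :
    Int.fract ((returnLift h ^ k) (angle lam p)) = angle lam (returnSeq a b lam p k) ∧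
    (if ⌊(returnLift h ^ (k + 1)) (angle lam p)⌋ - ⌊(returnLift h ^ k) (angle lam p)⌋ = 0
      then 4 else 6) = returnTime a lam (returnSeq a b lam p k) := by
  have hstep : ∀ x : ℝ, returnLift h x = returnLift h (Int.fract x) + ⌊x⌋ := by
    intro x
    rw [← CircleDeg1Lift.map_add_int, Int.fract_add_floor]
  have key : ∀ k, Int.fract ((returnLift h ^ k) (angle lam p))
      = angle lam (returnSeq a b lam p k) := by
    intro k
    induction k with
    | zero =>
      have := angle_mem h hp
      simpa [returnSeq] using Int.fract_eq_self.2 ⟨this.1.le, this.2⟩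
    | succ k ih =>
      obtain ⟨hk, hkr⟩ := returnSeq_mem h hp hpr k
      rw [pow_succ', CircleDeg1Lift.mul_apply, hstep, Int.fract_add_intCast, ih]
      exact (return_spec h hk hkr).2.1.symm
  refine ⟨key k, ?_⟩
  obtain ⟨hk, hkr⟩ := returnSeq_mem h hp hpr k
  rw [pow_succ', CircleDeg1Lift.mul_apply, hstep, Int.floor_add_intCast, key k, add_sub_cancel_right]
  exact (return_spec h hk hkr).2.2

/-- The length of a block, in terms of the label of the return at its end. -/
noncomputable def blockLength (h : Admissible a b lam) (m : ℕ) (w : Fin (m + 1 + 1) → Bool) : ℕ :=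
  if ⌊returnLift h 0⌋ + (if w 1 = true then 1 else 0) = 0 then 4 else 6

/-- Entry 1 of the label compares the angle with the fractional part of Φ 0; by the floor formula
this decides whether the last application of Φ crossed an integer, hence which branch was used. This
is why a block carries the label of the return at its end. -/
lemma blockLength_orbitLabel (h : Admissible a b lam) (m : ℕ) {p : ℝ × ℝ}
    (hp : p ∈ lowerStrip a lam) (hpr : p ∈ regularSet (quad a b) lam) (k : ℕ) :
    blockLength h m (orbitLabel (returnLift h) (m + 1)
      (Int.fract ((returnLift h ^ (k + 1)) (angle lam p))))
      = returnTime a lam (returnSeq a b lam p k) := by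
  rw [← (angle_returnSeq h hp hpr k).2, blockLength]
  have := floor_iterate_sub (returnLift_strictMono h) 1 ((returnLift h ^ k) (angle lam p))
  rw [← CircleDeg1Lift.mul_apply, ← pow_add, add_comm 1 k] at this
  rw [this]
  simp [orbitLabel]

/-- Returns with the same label are close to each other. -/
lemma dist_of_orbitLabel_eq (h : Admissible a b lam) {m : ℕ} {p q : ℝ × ℝ}
    (hp : p ∈ lowerStrip a lam) (hpr : p ∈ regularSet (quad a b) lam)
    (hq : q ∈ lowerStrip a lam) (hqr : q ∈ regularSet (quad a b) lam) {k l r : ℕ}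
    (heq : orbitLabel (returnLift h) (m + 1)
        (Int.fract ((returnLift h ^ (m + k + 1)) (angle lam p)))
      = orbitLabel (returnLift h) (m + 1)
        (Int.fract ((returnLift h ^ (m + l + 1)) (angle lam q))))
    (hr : r < returnTime a lam (returnSeq a b lam p (m + k))) :
    dist ((outerMap (quad a b) lam)^[r] (returnSeq a b lam p (m + k)))
      ((outerMap (quad a b) lam)^[r] (returnSeq a b lam q (m + l))) ≤ 2 * lam ^ m := by
  have hpow : ∀ (y : ℝ) (i k : ℕ), (returnLift h ^ (i + k)) y
      = (returnLift h ^ i) ((returnLift h ^ k) y) := by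
    intro y i k
    rw [pow_add, CircleDeg1Lift.mul_apply]
  rw [show m + k + 1 = m + 1 + k by ring, show m + l + 1 = m + 1 + l by ring, hpow _ (m + 1) k,
    hpow _ (m + 1) l] at heq
  have hrt : ∀ i ≤ m, returnTime a lam (returnSeq a b lam p (i + k))
      = returnTime a lam (returnSeq a b lam q (i + l)) := by
    intro i hi
    have := floor_increment_eq_of_orbitLabel_eq (returnLift_strictMono h) heq
      (Nat.lt_succ_of_le hi)
    rw [← hpow, ← hpow, ← hpow, ← hpow] at this
    rw [← (angle_returnSeq h hp hpr (i + k)).2, ← (angle_returnSeq h hq hqr (i + l)).2,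
      show i + k + 1 = i + 1 + k by ring, show i + l + 1 = i + 1 + l by ring, this]
  have hl0 := h.lam_pos
  have hl1 := h.lam_lt_one
  -- The strip has width lam (1 + lam) ≤ 2 and height at most 1, and distances are in the sup norm.
  have hd0 : dist (returnSeq a b lam p k) (returnSeq a b lam q l) ≤ 2 := by
    have h1 := (returnSeq_mem h hp hpr k).1
    have h2 := (returnSeq_mem h hq hqr l).1
    have hL : lam * (1 + lam) ≤ 2 := by nlinarith
    have hm : lam ^ 3 * margin a lam ≤ 1 := by
      have := margin_le h
      have := pow_le_one₀ (n := 3) hl0.le hl1.le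
      have := margin_pos h
      nlinarith
    rw [Prod.dist_eq, Real.dist_eq, Real.dist_eq]
    refine max_le (abs_le.2 ⟨?_, ?_⟩) (abs_le.2 ⟨?_, ?_⟩) <;>
      linarith [h1.1, h1.2.1, h1.2.2.1, h1.2.2.2, h2.1, h2.2.1, h2.2.2.1, h2.2.2.2]
  have hd : ∀ i ≤ m, dist (returnSeq a b lam p (i + k)) (returnSeq a b lam q (i + l))
      ≤ 2 * lam ^ i := by
    intro i
    induction i with
    | zero => intro _; simpa using hd0
    | succ i ih =>
      intro hi
      have hmp := returnSeq_mem h hp hpr (i + k)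
      have hmq := returnSeq_mem h hq hqr (i + l)
      rw [show i + 1 + k = i + k + 1 by ring, show i + 1 + l = i + l + 1 by ring, returnSeq,
        returnSeq, ← hrt i (by omega),
        dist_iterate_of_returnTime_eq h hmp.1 hmq.1 hmp.2 hmq.2 (hrt i (by omega)) le_rfl]
      have h1 := ih (by omega)
      have h2 : lam ^ returnTime a lam (returnSeq a b lam p (i + k)) ≤ lam := by
        simpa using pow_le_pow_of_le_one hl0.le hl1.le (one_le_returnTime (a := a) (lam := lam)
          (returnSeq a b lam p (i + k)))
      calc _ ≤ lam * (2 * lam ^ i) := mul_le_mul h2 h1 dist_nonneg hl0.le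
        _ = 2 * lam ^ (i + 1) := by ring
  have hmp := returnSeq_mem h hp hpr (m + k)
  have hmq := returnSeq_mem h hq hqr (m + l)
  rw [dist_iterate_of_returnTime_eq h hmp.1 hmq.1 hmp.2 hmq.2 (hrt m le_rfl) hr.le]
  exact (mul_le_of_le_one_left dist_nonneg (pow_le_one₀ hl0.le hl1.le)).trans (hd m le_rfl)

lemma iterate_blockStart (h : Admissible a b lam) (m e : ℕ) {x : ℝ × ℝ}
    (hx : x ∈ regularSet (quad a b) lam)
    (he : (outerMap (quad a b) lam)^[e] x ∈ lowerStrip a lam) (k : ℕ) :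
    (outerMap (quad a b) lam)^[blockStart (blockLength h m)
      (fun i => orbitLabel (returnLift h) (m + 1) (Int.fract ((returnLift h ^ (i + 1))
        (angle lam ((outerMap (quad a b) lam)^[e] x))))) e k] x
      = returnSeq a b lam ((outerMap (quad a b) lam)^[e] x) k := by
  induction k with
  | zero => simp [returnSeq]
  | succ k ih =>
    rw [blockStart_succ, add_comm, Function.iterate_add_apply, ih,
      blockLength_orbitLabel h m he (iterate_mem_regularSet h hx e) k, returnSeq]

lemma iterate_mem_trap (h : Admissible a b lam) {N : ℕ} {x : ℝ × ℝ} (hx : x ∈ basin a b lam N)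
    {n : ℕ} (hn : N ≤ n) : (outerMap (quad a b) lam)^[n] x ∈ trap a lam := by
  obtain ⟨hxr, e, he, hq⟩ := hx
  have hpos : ∀ c, 1 ≤ blockLength h 0 c := fun c => by
    rw [blockLength]; split_ifs <;> norm_num
  obtain ⟨k, r, hr, rfl⟩ := exists_block (h := blockLength h 0)
    (b := fun i => orbitLabel (returnLift h) (0 + 1) (Int.fract ((returnLift h ^ (i + 1))
        (angle lam ((outerMap (quad a b) lam)^[e] x))))) hpos (he.trans hn)
  have hreg := iterate_mem_regularSet h hxr e
  rw [blockLength_orbitLabel h 0 hq hreg k] at hr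
  rw [add_comm, Function.iterate_add_apply, iterate_blockStart h 0 e hxr hq]
  have := returnSeq_mem h hq hreg k
  exact mem_trap_of_mem_lowerStrip h this.1 this.2 hr

theorem hasUniformLabels_basin (h : Admissible a b lam) (N : ℕ) :
    HasUniformLabels (outerMap (quad a b) lam) (basin a b lam N) := by
  classical
  intro ε hε
  obtain ⟨m, hm⟩ : ∃ m : ℕ, 2 * lam ^ m < ε := by
    obtain ⟨m, hm⟩ := exists_pow_lt_of_lt_one (half_pos hε) h.lam_lt_one
    exact ⟨m, by linarith⟩
  have hrate := fun w => hasUniformRate_orbitLabel (returnLift_strictMono h) (m + 1) w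
  choose f C hfC using hrate
  have hpos : ∀ c, 1 ≤ blockLength h m c := fun c => by
    rw [blockLength]; split_ifs <;> norm_num
  have hle : ∀ c, blockLength h m c ≤ 6 := fun c => by
    rw [blockLength]; split_ifs <;> norm_num
  obtain ⟨F, C', hF⟩ := exists_time_labels (blockLength h m) 6 hpos hle f
    (∑ w, |C w|) N
  have hex : ∀ x, ∃ (p : ℝ × ℝ) (l : ℕ → Option ((Fin (m + 1 + 1) → Bool) × ℕ)),
      x ∈ basin a b lam N →
      p ∈ lowerStrip a lam ∧ p ∈ regularSet (quad a b) lam ∧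
      (∀ n, l n = none ∨ ∃ w, ∃ r < 6, l n = some (w, r)) ∧
      (∀ c n, |∑ j ∈ Finset.range n, (if l j = c then (1 : ℝ) else 0) - n * F c| ≤ C') ∧
      ∀ n ≥ N + 6 * (m + 1), ∃ k r, r < returnTime a lam (returnSeq a b lam p (m + k)) ∧
        (outerMap (quad a b) lam)^[n] x
          = (outerMap (quad a b) lam)^[r] (returnSeq a b lam p (m + k)) ∧
        l n = some (orbitLabel (returnLift h) (m + 1)
          (Int.fract ((returnLift h ^ (m + k + 1)) (angle lam p))), r) := by
    intro x
    by_cases hx : x ∈ basin a b lam N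
    swap
    · exact ⟨x, fun _ => none, fun hx' => absurd hx' hx⟩
    obtain ⟨hxr, e, he, hq⟩ := hx
    set p := (outerMap (quad a b) lam)^[e] x with hp
    have hreg : p ∈ regularSet (quad a b) lam := iterate_mem_regularSet h hxr e
    set B : ℕ → Fin (m + 1 + 1) → Bool := fun i => orbitLabel (returnLift h) (m + 1)
      (Int.fract ((returnLift h ^ (i + 1)) (angle lam p))) with hB
    -- Block i is labelled by return i + 1, so the labels follow the circle orbit of Φ applied to
    -- the initial angle; the rates do not depend on the starting point.
    obtain ⟨l, hl, hcount⟩ := hF B e he (by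
      intro w k
      have h1 := hfC w (returnLift h (angle lam p)) k
      have h2 : ∀ i, (returnLift h ^ i) (returnLift h (angle lam p))
          = (returnLift h ^ (i + 1)) (angle lam p) := by
        intro i
        rw [pow_succ, CircleDeg1Lift.mul_apply]
      simp only [h2] at h1
      have h3 : |C w| ≤ ∑ w, |C w| :=
        Finset.single_le_sum (f := fun w => |C w|) (fun _ _ => abs_nonneg _) (Finset.mem_univ w)
      refine le_trans (le_of_eq ?_) ((h1.trans (le_abs_self _)).trans h3)
      congr!)
    refine ⟨p, l, fun _ => ⟨hq, hreg, fun n => ?_, fun c n => ?_, fun n hn => ?_⟩⟩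
    · rcases hl n with h1 | ⟨k, r, hr, -, hlab⟩
      · exact Or.inl h1.2
      · exact Or.inr ⟨_, r, hr.trans_le (hle _), hlab⟩
    · convert hcount c n using 6
    · rcases hl n with h1 | ⟨k, r, hr, hnk, hlab⟩
      · omega
      -- The first block starts by time N and blocks have length at most 6. After N + 6 (m + 1)
      -- steps at least m returns precede the current block, as many as the label looks back.
      · have hmk : m ≤ k := by
          have h1 : blockStart (blockLength h m) B e k ≤ e + 6 * k := by
            rw [blockStart]
            have := Finset.sum_le_card_nsmul (Finset.range k) (fun i => blockLength h m (B i)) 6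
              fun i _ => hle _
            rw [Finset.card_range, smul_eq_mul] at this
            omega
          have h2 := hr.trans_le (hle _)
          omega
        obtain ⟨k, rfl⟩ := Nat.exists_eq_add_of_le hmk
        rw [hB, blockLength_orbitLabel h m hq hreg] at hr
        refine ⟨k, r, hr, ?_, hlab⟩
        rw [hnk, add_comm _ r, Function.iterate_add_apply, hB, hp,
          iterate_blockStart h m e hxr hq]
  choose p lab hlab using hex
  refine ⟨Option ((Fin (m + 1 + 1) → Bool) × ℕ),
    insert none ((Finset.univ ×ˢ Finset.range 6).image some), lab, F, C', N + 6 * (m + 1),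
    fun x hx n => ?_, fun x hx c n => ?_, fun x hx y hy i hi j hj hij => ?_⟩
  · rcases (hlab x hx).2.2.1 n with h1 | ⟨w, r, hr, h1⟩
    · rw [h1]; simp
    · rw [h1]; simp [hr]
  · convert (hlab x hx).2.2.2.1 c n using 6
  · obtain ⟨hp, hpr, -, -, hx⟩ := hlab x hx
    obtain ⟨hq, hqr, -, -, hy⟩ := hlab y hy
    obtain ⟨k, r, hr, hxi, hli⟩ := hx i hi
    obtain ⟨k', r', hr', hyj, hlj⟩ := hy j hj
    rw [hli, hlj, Option.some.injEq, Prod.mk.injEq] at hij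
    obtain ⟨hw, rfl⟩ := hij
    rw [hxi, hyj]
    exact (dist_of_orbitLabel_eq h hp hpr hq hqr hw hr).trans_lt hm

end Labels

/-! ### Invariant measures as limits of empirical measures -/

section KrylovBogoliubov

variable {Y : Type*} [MeasurableSpace Y]

/-- The empirical measure of the first `n + 1` points of a sequence. -/
noncomputable def empirical (y : ℕ → Y) (n : ℕ) : Measure Y :=
  ((n + 1 : ℕ) : ENNReal)⁻¹ • ∑ i ∈ Finset.range (n + 1), Measure.dirac (y i)

lemma isProbabilityMeasure_empirical (y : ℕ → Y) (n : ℕ) : IsProbabilityMeasure (empirical y n) := by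
  constructor
  rw [empirical, Measure.smul_apply, Measure.finsetSum_apply]
  simp only [measure_univ, Finset.sum_const, Finset.card_range, smul_eq_mul, nsmul_eq_mul, mul_one]
  exact ENNReal.inv_mul_cancel (by simp) (ENNReal.natCast_ne_top _)

variable [TopologicalSpace Y] [BorelSpace Y]

lemma integral_empirical (y : ℕ → Y) (n : ℕ) (f : BoundedContinuousFunction Y ℝ) :
    ∫ z, f z ∂(empirical y n) = ((n + 1 : ℕ) : ℝ)⁻¹ * ∑ i ∈ Finset.range (n + 1), f (y i) := by
  rw [empirical, integral_smul_measure, integral_finsetSum_measure fun i _ => f.integrable _]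
  rw [ENNReal.toReal_inv, ENNReal.toReal_natCast, smul_eq_mul]
  simp_rw [integral_dirac' _ _ f.continuous.stronglyMeasurable]

/-- A continuous map of a compact space has an invariant probability measure which is a limit of
empirical measures of a given orbit. -/
theorem exists_invariant_of_orbit [CompactSpace Y] [T2Space Y] [HasOuterApproxClosed Y] (σ : Y → Y) (hσ : Continuous σ) (y : Y) :
    ∃ m : Measure Y, IsProbabilityMeasure m ∧ m.map σ = m ∧
      ∀ f : BoundedContinuousFunction Y ℝ,
        Tendsto (fun i => f (σ^[i] y)) atTop (𝓝 0) → ∫ z, f z ∂m = 0 := by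
  have hprob := isProbabilityMeasure_empirical fun i => σ^[i] y
  set e : ℕ → ProbabilityMeasure Y := fun n => ⟨empirical (fun i => σ^[i] y) n, hprob n⟩ with he
  -- The space of probability measures on Y is compact, so the empirical measures converge along a
  -- nonprincipal ultrafilter.
  set u : Ultrafilter ℕ := hyperfilter ℕ
  have hu : (u : Filter ℕ) ≤ atTop := Nat.hyperfilter_le_atTop
  set m := (u.map e).lim with hm
  have hlim : Tendsto e u (𝓝 m) := Ultrafilter.le_nhds_lim (u.map e)
  rw [ProbabilityMeasure.tendsto_iff_forall_integral_tendsto] at hlim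
  have hlim' : ∀ f : BoundedContinuousFunction Y ℝ,
      Tendsto (fun n : ℕ => ((n + 1 : ℕ) : ℝ)⁻¹ * ∑ i ∈ Finset.range (n + 1), f (σ^[i] y)) u
        (𝓝 (∫ z, f z ∂(m : Measure Y))) := by
    intro f
    refine (hlim f).congr fun n => ?_
    exact integral_empirical _ n f
  refine ⟨m, inferInstance, ?_, fun f hf => ?_⟩
  · have : IsProbabilityMeasure ((m : Measure Y).map σ) :=
      Measure.isProbabilityMeasure_map hσ.measurable.aemeasurable
    refine ext_of_forall_integral_eq_of_IsFiniteMeasure fun f => ?_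
    rw [integral_map hσ.measurable.aemeasurable f.continuous.aestronglyMeasurable]
    have h1 := (hlim' (f.compContinuous ⟨σ, hσ⟩)).sub (hlim' f)
    -- The averages of f ∘ σ and of f differ by a telescoping sum, at most 2 ‖f‖ / (n + 1).
    have h2 : Tendsto (fun n : ℕ => ((n + 1 : ℕ) : ℝ)⁻¹ * (f (σ^[n + 1] y) - f y)) atTop (𝓝 0) := by
      have h3 : Tendsto (fun n : ℕ => ((n + 1 : ℕ) : ℝ)⁻¹ * (2 * ‖f‖)) atTop (𝓝 0) := by
        have := (tendsto_inv_atTop_zero.comp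
          ((tendsto_natCast_atTop_atTop (R := ℝ)).comp (tendsto_add_atTop_nat 1))).mul_const (2 * ‖f‖)
        simpa using this
      refine squeeze_zero_norm (fun n => ?_) h3
      rw [norm_mul, Real.norm_of_nonneg (by positivity : (0 : ℝ) ≤ ((n + 1 : ℕ) : ℝ)⁻¹)]
      refine mul_le_mul_of_nonneg_left ?_ (by positivity)
      have e1 := f.norm_coe_le_norm (σ^[n + 1] y)
      have e2 := f.norm_coe_le_norm y
      linarith [norm_sub_le (f (σ^[n + 1] y)) (f y)]
    have h4 := tendsto_nhds_unique (h1.congr fun n => ?_) (h2.mono_left hu)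
    · exact sub_eq_zero.1 h4
    · rw [← mul_sub, ← Finset.sum_sub_distrib]
      congr 1
      have := Finset.sum_range_sub (fun i => f (σ^[i] y)) (n + 1)
      rw [Function.iterate_zero, id] at this
      rw [← this]
      refine Finset.sum_congr rfl fun i _ => ?_
      rw [Function.iterate_succ_apply']
      rfl
  · refine tendsto_nhds_unique (hlim' f) (Tendsto.mono_left ?_ hu)
    exact hf.cesaro.comp (tendsto_add_atTop_nat 1)

end KrylovBogoliubov

/-! ### Common limit sets and unique ergodicity from uniform labels -/

section Attractor

variable {E : Type*} [MetricSpace E] {T : E → E} {W : Set E}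

/-- Infinitely many occurrences of P make its counting function unbounded, which forces the common
rate F to be positive; then the count for Q also grows linearly. -/
lemma HasUniformLabels.frequently {P Q : ℕ → Prop} [DecidablePred P] [DecidablePred Q] {F C : ℝ}
    (hP : ∀ n : ℕ, |∑ j ∈ Finset.range n, (if P j then (1 : ℝ) else 0) - n * F| ≤ C)
    (hQ : ∀ n : ℕ, |∑ j ∈ Finset.range n, (if Q j then (1 : ℝ) else 0) - n * F| ≤ C)
    (hfreq : ∃ᶠ n in atTop, P n) : ∃ᶠ n in atTop, Q n := by
  have hunb : ∀ K : ℕ, ∃ n, (K : ℝ) ≤ ∑ j ∈ Finset.range n, (if P j then (1 : ℝ) else 0) := by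
    intro K
    induction K with
    | zero => exact ⟨0, by simp⟩
    | succ K ih =>
      obtain ⟨n, hn⟩ := ih
      obtain ⟨m, hm, hPm⟩ := frequently_atTop.1 hfreq n
      refine ⟨m + 1, ?_⟩
      rw [Finset.sum_range_succ, if_pos hPm]
      have : ∑ j ∈ Finset.range n, (if P j then (1 : ℝ) else 0)
          ≤ ∑ j ∈ Finset.range m, (if P j then (1 : ℝ) else 0) :=
        Finset.sum_le_sum_of_subset_of_nonneg (Finset.range_subset_range.2 hm)
          fun _ _ _ => by split_ifs <;> norm_num
      push_cast
      linarith
  have hF : 0 < F := by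
    by_contra hF
    push Not at hF
    obtain ⟨K, hK⟩ := exists_nat_gt C
    obtain ⟨n, hn⟩ := hunb K
    have h1 := (abs_le.1 (hP n)).2
    have h2 : (n : ℝ) * F ≤ 0 := mul_nonpos_of_nonneg_of_nonpos (Nat.cast_nonneg n) hF
    linarith
  by_contra hcon
  rw [not_frequently, eventually_atTop] at hcon
  obtain ⟨N, hN⟩ := hcon
  obtain ⟨n, hn⟩ := exists_nat_gt ((C + N) / F)
  rw [div_lt_iff₀ hF] at hn
  have h1 := (abs_le.1 (hQ (N + n))).1
  have h2 : ∑ j ∈ Finset.range (N + n), (if Q j then (1 : ℝ) else 0) ≤ N := by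
    rw [Finset.sum_range_add, Finset.sum_eq_zero (s := Finset.range n)
      fun i _ => if_neg (hN _ (Nat.le_add_right _ _)), add_zero]
    have : ∑ i ∈ Finset.range N, (if Q i then (1 : ℝ) else 0) ≤ ∑ i ∈ Finset.range N, 1 :=
      Finset.sum_le_sum fun i _ => by split_ifs <;> norm_num
    simpa using this
  push_cast at h1
  nlinarith [mul_nonneg (Nat.cast_nonneg (α := ℝ) N) hF.le]

/-- All the points of `W` have the same `ω`-limit set. -/
theorem HasUniformLabels.omegaLimit_subset (hW : HasUniformLabels T W) {x y : E} (hx : x ∈ W)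
    (hy : y ∈ W) : omegaLimit atTop (fun (n : ℕ) (x : E) => T^[n] x) {x}
      ⊆ omegaLimit atTop (fun (n : ℕ) (x : E) => T^[n] x) {y} := by
  classical
  intro z hz
  rw [mem_omegaLimit_singleton_iff_mapClusterPt, mapClusterPt_iff_frequently] at hz ⊢
  intro s hs
  obtain ⟨ε, hε, hball⟩ := Metric.mem_nhds_iff.1 hs
  obtain ⟨ι, S, lab, F, C, n₀, hS, hcount, hdist⟩ := hW (ε / 2) (half_pos hε)
  have hfr := hz _ (Metric.ball_mem_nhds z (half_pos hε))
  -- By pigeonhole over the finite set of labels, one label recurs at visits close to z. It recurs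
  -- along the orbit of y too, and late points with equal labels are close.
  obtain ⟨c, hc⟩ : ∃ c, ∃ᶠ n in atTop, lab x n = c ∧ T^[n] x ∈ Metric.ball z (ε / 2) := by
    by_contra! hcon
    have h1 : ∀ c ∈ S, ∀ᶠ n in atTop, ¬ (lab x n = c ∧ T^[n] x ∈ Metric.ball z (ε / 2)) :=
      fun c _ => by
        simpa only [not_and] using hcon c
    have h2 := (eventually_all_finset S).2 h1
    obtain ⟨n, hn, hn'⟩ := (hfr.and_eventually h2).exists
    exact hn' _ (hS x hx n) ⟨rfl, hn⟩
  obtain ⟨n, hn, hnc, hnz⟩ := frequently_atTop.1 hc n₀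
  have hfy : ∃ᶠ n in atTop, lab y n = c :=
    HasUniformLabels.frequently (F := F c) (C := C)
      (fun n => by convert hcount x hx c n using 6) (fun n => by convert hcount y hy c n using 6)
      (hc.mono fun _ h => h.1)
  refine ((hfy.and_eventually (eventually_ge_atTop n₀)).mono) fun k hk => hball ?_
  have h1 := hdist y hy x hx k hk.2 n hn (hk.1.trans hnc.symm)
  rw [Metric.mem_ball] at hnz ⊢
  linarith [dist_triangle (T^[k] y) (T^[n] x) z]

/-- The Birkhoff sums over `W` of a continuous function are uniformly close to linear. -/
theorem HasUniformLabels.birkhoff (hW : HasUniformLabels T W) {J : Set E} (hJ : IsCompact J)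
    {N : ℕ} (hWJ : ∀ x ∈ W, ∀ n ≥ N, T^[n] x ∈ J) (φ : BoundedContinuousFunction E ℝ) {ε : ℝ}
    (hε : 0 < ε) : ∃ Λ C : ℝ, ∀ x ∈ W, ∀ n : ℕ,
      |∑ j ∈ Finset.range n, φ (T^[j] x) - n * Λ| ≤ ε * n + C := by
  classical
  have hUC := hJ.uniformContinuousOn_of_continuous φ.continuous.continuousOn
  rw [Metric.uniformContinuousOn_iff] at hUC
  obtain ⟨δ, hδ, hφδ⟩ := hUC ε hε
  obtain ⟨ι, S, lab, F, C, n₀, hS, hcount, hdist⟩ := hW δ hδ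
  set n₁ := max n₀ N with hn₁
  -- Each label gets the value of φ at one late orbit point that carries it, or 0 if there is none.
  -- Late points with that label lie in J and are within δ of the chosen one.
  have hval : ∀ c : ι, ∃ v : ℝ, |v| ≤ ‖φ‖ ∧
      ∀ x ∈ W, ∀ n ≥ n₁, lab x n = c → |φ (T^[n] x) - v| ≤ ε := by
    intro c
    by_cases hc : ∃ y ∈ W, ∃ m ≥ n₁, lab y m = c
    · obtain ⟨y, hy, m, hm, hmc⟩ := hc
      refine ⟨φ (T^[m] y), φ.norm_coe_le_norm _, fun x hx n hn hnc => ?_⟩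
      have h1 := hdist x hx y hy n ((le_max_left _ _).trans hn) m ((le_max_left _ _).trans hm)
        (hnc.trans hmc.symm)
      exact (hφδ _ (hWJ x hx n ((le_max_right _ _).trans hn)) _
        (hWJ y hy m ((le_max_right _ _).trans hm)) h1).le
    · refine ⟨0, by simp, fun x hx n hn hnc => absurd ⟨x, hx, n, hn, hnc⟩ hc⟩
  choose v hv hvφ using hval
  -- The constant collects the n₁ initial times, where the approximation may fail, and the counting
  -- errors of the labels.
  refine ⟨∑ c ∈ S, v c * F c, n₁ * (2 * ‖φ‖) + ∑ c ∈ S, |v c| * C, fun x hx n => ?_⟩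
  have h1 : ∑ j ∈ Finset.range n, v (lab x j)
      = ∑ c ∈ S, v c * ∑ j ∈ Finset.range n, (if lab x j = c then (1 : ℝ) else 0) := by
    simp_rw [Finset.mul_sum]
    rw [Finset.sum_comm]
    refine Finset.sum_congr rfl fun j _ => ?_
    simp [hS x hx j]
  have h2 : |∑ j ∈ Finset.range n, v (lab x j) - n * ∑ c ∈ S, v c * F c|
      ≤ ∑ c ∈ S, |v c| * C := by
    rw [h1, Finset.mul_sum, ← Finset.sum_sub_distrib]
    refine (Finset.abs_sum_le_sum_abs _ _).trans (Finset.sum_le_sum fun c _ => ?_)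
    have h3 := hcount x hx c n
    rw [show ∀ s : ℝ, v c * s - n * (v c * F c) = v c * (s - n * F c) by intro s; ring, abs_mul]
    refine mul_le_mul_of_nonneg_left ?_ (abs_nonneg _)
    convert h3 using 6
  have h4 : |∑ j ∈ Finset.range n, (φ (T^[j] x) - v (lab x j))| ≤ ε * n + n₁ * (2 * ‖φ‖) := by
    have h5 : ∀ j, |φ (T^[j] x) - v (lab x j)| ≤ ε + if j < n₁ then 2 * ‖φ‖ else 0 := by
      intro j
      split_ifs with hj
      · have e1 := φ.norm_coe_le_norm (T^[j] x)
        have e2 := hv (lab x j)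
        rw [Real.norm_eq_abs] at e1
        linarith [abs_sub (φ (T^[j] x)) (v (lab x j))]
      · rw [add_zero]
        exact hvφ _ x hx j (not_lt.1 hj) rfl
    refine (Finset.abs_sum_le_sum_abs _ _).trans ((Finset.sum_le_sum fun j _ => h5 j).trans ?_)
    rw [Finset.sum_add_distrib, Finset.sum_const, Finset.card_range, nsmul_eq_mul, mul_comm ε,
      ← Finset.sum_filter, Finset.sum_const, nsmul_eq_mul]
    have h6 : ((Finset.range n).filter (· < n₁)).card ≤ n₁ := by
      have : (Finset.range n).filter (· < n₁) ⊆ Finset.range n₁ := fun j hj =>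
        Finset.mem_range.2 (Finset.mem_filter.1 hj).2
      simpa using Finset.card_le_card this
    have h7 : (((Finset.range n).filter (· < n₁)).card : ℝ) ≤ n₁ := by exact_mod_cast h6
    have := mul_le_mul_of_nonneg_right h7 (by positivity : 0 ≤ 2 * ‖φ‖)
    linarith
  rw [Finset.sum_sub_distrib] at h4
  have e1 := abs_le.1 h2
  have e2 := abs_le.1 h4
  rw [abs_le]
  constructor <;> linarith

/-- The closure of the set of orbits of the points of `R`. -/
def orbitClosure (T : E → E) (R : Set E) : Set (ℕ → E) :=
  closure ((fun x (n : ℕ) => T^[n] x) '' R)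

lemma continuous_shift : Continuous (fun (s : ℕ → E) (n : ℕ) => s (n + 1)) :=
  continuous_pi fun n => continuous_apply (n + 1)

variable [MeasurableSpace E]

/-- `μ` is the law of the initial point under a shift-invariant probability measure which is carried
by the closure of the set of orbits. -/
def IsOrbitInvariant (T : E → E) (R : Set E) (μ : Measure E) : Prop :=
  ∃ M : Measure (ℕ → E), IsProbabilityMeasure M ∧ M (orbitClosure T R)ᶜ = 0 ∧
    M.map (fun s n => s (n + 1)) = M ∧ M.map (fun s => s 0) = μ

lemma IsOrbitInvariant.isProbabilityMeasure {R : Set E} {μ : Measure E}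
    (hμ : IsOrbitInvariant T R μ) : IsProbabilityMeasure μ := by
  obtain ⟨M, hM, -, -, rfl⟩ := hμ
  exact Measure.isProbabilityMeasure_map (measurable_pi_apply 0).aemeasurable

variable [BorelSpace E] [SecondCountableTopology E]

/-- Existence of an invariant measure carried by an `ω`-limit set. -/
theorem exists_isOrbitInvariant {R J : Set E} (hR : ∀ x ∈ R, T x ∈ R) (hJ : IsCompact J) {x : E}
    (hx : x ∈ R) (hxJ : ∀ᶠ n in atTop, T^[n] x ∈ J) :
    ∃ μ : Measure E, IsOrbitInvariant T R μ ∧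
      μ (omegaLimit atTop (fun (n : ℕ) (x : E) => T^[n] x) {x})ᶜ = 0 := by
  set K := omegaLimit atTop (fun (n : ℕ) (x : E) => T^[n] x) {x} with hK
  have hKclosed : IsClosed K := isClosed_omegaLimit _ _ _
  obtain ⟨N, hN⟩ := eventually_atTop.1 hxJ
  have hev : ∀ᶠ n : ℕ in atTop, Set.MapsTo (fun x : E => T^[n] x) {x} J := by
    filter_upwards [hxJ] with n hn
    rintro _ rfl
    exact hn
  have hKne : K.Nonempty := by
    refine nonempty_omegaLimit_of_isCompact_absorbing _ _ _ hJ
      ⟨Set.Ici N, mem_atTop N, closure_minimal ?_ hJ.isClosed⟩ (Set.singleton_nonempty x)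
    rintro _ ⟨n, hn, _, rfl, rfl⟩
    exact hN n hn
  have hdist : Tendsto (fun n : ℕ => Metric.infDist (T^[n] x) K) atTop (𝓝 0) := by
    rw [Metric.tendsto_atTop']
    intro ε hε
    have h1 := eventually_mapsTo_of_isCompact_absorbing_of_isOpen_of_omegaLimit_subset atTop
      (fun (n : ℕ) (x : E) => T^[n] x) {x} hJ hev (Metric.isOpen_thickening (δ := ε) (E := K))
      (Metric.self_subset_thickening hε K)
    obtain ⟨n₁, h2⟩ := eventually_atTop.1 h1
    refine ⟨n₁, fun n hn => ?_⟩
    have h3 : T^[n] x ∈ Metric.thickening ε K := h2 n hn.le rfl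
    obtain ⟨z, hz, hzd⟩ := Metric.mem_thickening_iff.1 h3
    rw [Real.dist_eq, sub_zero, abs_of_nonneg Metric.infDist_nonneg]
    exact (Metric.infDist_le_dist_of_mem hz).trans_lt hzd
  -- the closure of the set of shifts of the orbit
  set o : ℕ → ℕ → E := fun i n => T^[n] (T^[i] x) with ho
  set Y := closure (Set.range o) with hY
  have hYc : IsCompact Y := by
    set J' := ((fun n => T^[n] x) '' Set.Iio N) ∪ J with hJ'
    have hJ'c : IsCompact J' := ((Set.finite_Iio N).image _).isCompact.union hJ
    have hall : ∀ n, T^[n] x ∈ J' := by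
      intro n
      rcases lt_or_ge n N with h | h
      · exact Or.inl ⟨n, h, rfl⟩
      · exact Or.inr (hN n h)
    have hpi : IsCompact (Set.univ.pi fun _ : ℕ => J') := isCompact_univ_pi fun _ => hJ'c
    refine hpi.of_isClosed_subset isClosed_closure (closure_minimal ?_ hpi.isClosed)
    rintro _ ⟨i, rfl⟩ n _
    simp only [ho]
    rw [← Function.iterate_add_apply]
    exact hall _
  have hYgen : Y ⊆ orbitClosure T R := by
    refine closure_mono ?_
    rintro _ ⟨i, rfl⟩
    refine ⟨T^[i] x, ?_, rfl⟩
    induction i with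
    | zero => exact hx
    | succ i ih => rw [Function.iterate_succ_apply']; exact hR _ ih
  have hmaps : Set.MapsTo (fun (s : ℕ → E) (n : ℕ) => s (n + 1)) Y Y := by
    refine Set.MapsTo.closure ?_ continuous_shift
    rintro _ ⟨i, rfl⟩
    refine ⟨i + 1, ?_⟩
    funext n
    simp only [ho]
    rw [← Function.iterate_add_apply, ← Function.iterate_add_apply]
    rw [show n + (i + 1) = n + 1 + i by ring]
  have : CompactSpace Y := isCompact_iff_compactSpace.1 hYc
  set σ : Y → Y := hmaps.restrict _ _ _ with hσ
  have hσc : Continuous σ := continuous_shift.restrict hmaps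
  obtain ⟨m, hm, hmσ, hm0⟩ := exists_invariant_of_orbit σ hσc
    (⟨o 0, subset_closure ⟨0, rfl⟩⟩ : Y)
  have hval : Measurable (Subtype.val : Y → ℕ → E) := measurable_subtype_coe
  have hsm : Measurable (fun (s : ℕ → E) (n : ℕ) => s (n + 1)) :=
    measurable_pi_lambda _ fun n => measurable_pi_apply (n + 1)
  refine ⟨(m.map Subtype.val).map fun s => s 0, ⟨m.map Subtype.val,
    Measure.isProbabilityMeasure_map hval.aemeasurable, ?_, ?_, rfl⟩, ?_⟩
  · have hmeas : MeasurableSet (orbitClosure T R)ᶜ := isClosed_closure.measurableSet.compl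
    rw [Measure.map_apply hval hmeas]
    convert measure_empty (μ := m)
    ext s
    simp only [Set.mem_preimage, Set.mem_compl_iff, Set.mem_empty_iff_false, iff_false, not_not]
    exact hYgen s.2
  · rw [Measure.map_map hsm hval]
    have : (fun (s : ℕ → E) (n : ℕ) => s (n + 1)) ∘ (Subtype.val : Y → ℕ → E)
        = Subtype.val ∘ σ := rfl
    rw [this, ← Measure.map_map hval hσc.measurable, hmσ]
  -- The distance of the initial coordinate to K tends to 0 along the shifted orbit, so its integral
  -- vanishes; being nonnegative, it vanishes almost everywhere.
  · have hcont : Continuous fun s : Y => Metric.infDist ((s : ℕ → E) 0) K :=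
      (Metric.continuous_infDist_pt K).comp ((continuous_apply 0).comp continuous_subtype_val)
    set f := BoundedContinuousFunction.mkOfCompact (⟨_, hcont⟩ : C(Y, ℝ)) with hf
    have hfi : ∀ i, f (σ^[i] ⟨o 0, subset_closure ⟨0, rfl⟩⟩) = Metric.infDist (T^[i] x) K := by
      have hσi : ∀ i, ((σ^[i] ⟨o 0, subset_closure ⟨0, rfl⟩⟩ : Y) : ℕ → E) = o i := by
        intro i
        induction i with
        | zero => rfl
        | succ i ih =>
          rw [Function.iterate_succ_apply']
          change (fun n => ((σ^[i] _ : Y) : ℕ → E) (n + 1)) = _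
          rw [ih]
          funext n
          simp only [ho]
          rw [← Function.iterate_add_apply, ← Function.iterate_add_apply]
          rw [show n + 1 + i = n + (i + 1) by ring]
      intro i
      change Metric.infDist (((σ^[i] _ : Y) : ℕ → E) 0) K = _
      rw [hσi]
      rfl
    have h0 : ∫ z, f z ∂m = 0 := hm0 f (by simpa only [hfi] using hdist)
    have h1 : (fun z => f z) =ᵐ[m] 0 :=
      (integral_eq_zero_iff_of_nonneg (fun _ => Metric.infDist_nonneg) (f.integrable m)).1 h0
    rw [Measure.map_map (measurable_pi_apply 0) hval, Measure.map_apply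
      ((measurable_pi_apply 0).comp hval) hKclosed.measurableSet.compl]
    refine measure_mono_null ?_ (ae_iff.1 h1)
    intro s hs hs0
    exact hs ((hKclosed.mem_iff_infDist_zero hKne).2 hs0)

/-- The integral of a function with uniformly controlled Birkhoff sums against an invariant
measure. -/
theorem IsOrbitInvariant.abs_integral_sub_le {R K O : Set E} {μ : Measure E}
    (hμ : IsOrbitInvariant T R μ) (hK : IsClosed K) (hμK : μ Kᶜ = 0) (hO : IsOpen O) (hKO : K ⊆ O)
    (hOW : R ∩ O ⊆ W) (φ : BoundedContinuousFunction E ℝ) {ε Λ C : ℝ}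
    (hφ : ∀ x ∈ W, ∀ n : ℕ, |∑ j ∈ Finset.range n, φ (T^[j] x) - n * Λ| ≤ ε * n + C) :
    |∫ z, φ z ∂μ - Λ| ≤ ε := by
  obtain ⟨M, hM, hMgen, hMσ, hM0⟩ := hμ
  have hsm : Measurable (fun (s : ℕ → E) (n : ℕ) => s (n + 1)) :=
    measurable_pi_lambda _ fun n => measurable_pi_apply (n + 1)
  have hmp : MeasurePreserving (fun (s : ℕ → E) (n : ℕ) => s (n + 1)) M M := ⟨hsm, hMσ⟩
  have hcoord : ∀ j : ℕ, M.map (fun s => s j) = μ := by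
    intro j
    induction j with
    | zero => exact hM0
    | succ j ih =>
      rw [← ih]
      conv_rhs => rw [← hMσ]
      rw [Measure.map_map (measurable_pi_apply j) hsm]
      rfl
  have hφj : ∀ j : ℕ, Continuous fun s : ℕ → E => φ (s j) := fun j =>
    φ.continuous.comp (continuous_apply j)
  have hint : ∀ j : ℕ, Integrable (fun s : ℕ → E => φ (s j)) M := fun j =>
    Integrable.of_bound (hφj j).aestronglyMeasurable ‖φ‖
      (Eventually.of_forall fun s => φ.norm_coe_le_norm _)
  have hintj : ∀ j : ℕ, ∫ s, φ (s j) ∂M = ∫ z, φ z ∂μ := by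
    intro j
    rw [← hcoord j, integral_map (measurable_pi_apply j).aemeasurable
      φ.continuous.aestronglyMeasurable]
  -- Almost every s starts in K, inside the open set O, so it is a limit of genuine orbits that
  -- start in R ∩ O and hence in W. For fixed n the estimate is a closed condition on finitely many
  -- coordinates and survives the limit.
  have hae : ∀ᵐ s ∂M, ∀ n : ℕ, |∑ j ∈ Finset.range n, φ (s j) - n * Λ| ≤ ε * n + C := by
    have h1 : ∀ᵐ s ∂M, s ∈ orbitClosure T R := mem_ae_iff.2 hMgen
    have h2 : ∀ᵐ s ∂M, s 0 ∈ K := by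
      rw [← hM0, Measure.map_apply (measurable_pi_apply 0) hK.measurableSet.compl] at hμK
      exact mem_ae_iff.2 hμK
    filter_upwards [h1, h2] with s hs hs0 n
    have h3 : s ∈ closure ((fun s : ℕ → E => s 0) ⁻¹' O ∩ ((fun x (n : ℕ) => T^[n] x) '' R)) :=
      (hO.preimage (continuous_apply 0)).inter_closure ⟨hKO hs0, hs⟩
    have hclosed : IsClosed {s : ℕ → E | |∑ j ∈ Finset.range n, φ (s j) - n * Λ| ≤ ε * n + C} :=
      isClosed_le (((continuous_finsetSum _ fun j _ => hφj j).sub continuous_const).abs)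
        continuous_const
    refine closure_minimal ?_ hclosed h3
    rintro _ ⟨hO', x, hx, rfl⟩
    exact hφ x (hOW ⟨hx, hO'⟩) n
  -- Every coordinate has law μ, so integrating the sum gives n times the integral of φ; letting n
  -- grow removes C.
  have hbound : ∀ n : ℕ, n * |∫ z, φ z ∂μ - Λ| ≤ ε * n + C := by
    intro n
    have h1 : ∫ s, (∑ j ∈ Finset.range n, φ (s j) - n * Λ) ∂M = n * (∫ z, φ z ∂μ - Λ) := by
      rw [integral_sub (integrable_finsetSum _ fun j _ => hint j) (integrable_const _),
        integral_finsetSum _ fun j _ => hint j, Finset.sum_congr rfl fun j _ => hintj j]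
      simp
      ring
    have h2 := norm_integral_le_of_norm_le_const (μ := M)
      (hae.mono fun s hs => (Real.norm_eq_abs _).trans_le (hs n))
    rw [h1, Real.norm_eq_abs, abs_mul, Nat.abs_cast] at h2
    simpa using h2
  by_contra hcon
  push Not at hcon
  obtain ⟨n, hn⟩ := exists_nat_gt (C / (|∫ z, φ z ∂μ - Λ| - ε))
  rw [div_lt_iff₀ (by linarith)] at hn
  nlinarith [hbound n]

/-- A system of basins with uniform labels has a unique attractor, and this attractor is uniquely
ergodic. -/
theorem exists_uniquely_ergodic_attractor {R U J O : Set E} {B : ℕ → Set E} {N₀ : ℕ} {x₀ : E}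
    (hR : ∀ x ∈ R, T x ∈ R) (hU : IsClosed U) (hRU : R ⊆ U) (hB : Monotone B)
    (hBR : ∀ N, B N ⊆ R) (hlab : ∀ N, HasUniformLabels T (B N)) (hJ : IsCompact J)
    (hBJ : ∀ N, ∀ x ∈ B N, ∀ n ≥ N, T^[n] x ∈ J) (hO : IsOpen O) (hJO : J ⊆ O)
    (hOB : R ∩ O ⊆ B N₀) (hx₀ : x₀ ∈ B N₀) :
    ∃ K : Set E, (∀ N, ∀ x ∈ B N, omegaLimit atTop (fun (n : ℕ) (x : E) => T^[n] x) {x} = K) ∧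
      ∃ μ : Measure E, (IsOrbitInvariant T R μ ∧ μ Kᶜ = 0) ∧
        (∀ ν : Measure E, IsOrbitInvariant T R ν → ν Kᶜ = 0 → ν = μ) ∧
        ∀ N, ∀ x ∈ B N, ∀ φ : E → ℝ, ContinuousOn φ U → IntegrableOn φ K μ ∧
          Tendsto (fun n : ℕ => birkhoffAverage ℝ T φ n x) atTop (𝓝 (∫ y in K, φ y ∂μ)) := by
  have hRn : ∀ x ∈ R, ∀ n, T^[n] x ∈ R := by
    intro x hx n
    induction n with
    | zero => exact hx
    | succ n ih => rw [Function.iterate_succ_apply']; exact hR _ ih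
  set K := omegaLimit atTop (fun (n : ℕ) (x : E) => T^[n] x) {x₀} with hK
  have hKclosed : IsClosed K := isClosed_omegaLimit _ _ _
  have hKsub : ∀ {Z : Set E}, IsClosed Z → (∀ n ≥ N₀, T^[n] x₀ ∈ Z) → K ⊆ Z := by
    intro Z hZ hn
    refine (Set.iInter₂_subset (Set.Ici N₀) (mem_atTop N₀)).trans (closure_minimal ?_ hZ)
    rintro _ ⟨n, hn', _, rfl, rfl⟩
    exact hn n hn'
  have hKJ : K ⊆ J := hKsub hJ.isClosed fun n hn => hBJ N₀ x₀ hx₀ n hn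
  have hKU : K ⊆ U := hKsub hU fun n _ => hRU (hRn _ (hBR _ hx₀) n)
  obtain ⟨μ, hμ, hμK⟩ := exists_isOrbitInvariant hR hJ (hBR _ hx₀)
    (eventually_atTop.2 ⟨N₀, fun n hn => hBJ N₀ x₀ hx₀ n hn⟩)
  have := hμ.isProbabilityMeasure
  refine ⟨K, fun N x hx => ?_, μ, ⟨hμ, hμK⟩, fun ν hν hνK => ?_, fun N x hx φ hφ => ?_⟩
  -- Both points lie in a common basin, where the comparison of limit sets applies in both
  -- directions.
  · have hx' : x ∈ B (max N N₀) := hB (le_max_left _ _) hx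
    have hx₀' : x₀ ∈ B (max N N₀) := hB (le_max_right _ _) hx₀
    exact Set.Subset.antisymm ((hlab _).omegaLimit_subset hx' hx₀')
      ((hlab _).omegaLimit_subset hx₀' hx')
  · have := hν.isProbabilityMeasure
    refine ext_of_forall_integral_eq_of_IsFiniteMeasure fun φ => ?_
    refine eq_of_forall_dist_le fun ε hε => ?_
    obtain ⟨Λ, C, h⟩ := (hlab N₀).birkhoff hJ (hBJ N₀) φ (half_pos hε)
    have h1 := hν.abs_integral_sub_le hKclosed hνK hO (hKJ.trans hJO) hOB φ h
    have h2 := hμ.abs_integral_sub_le hKclosed hμK hO (hKJ.trans hJO) hOB φ h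
    rw [Real.dist_eq]
    have e1 := abs_le.1 h1
    have e2 := abs_le.1 h2
    rw [abs_le]
    constructor <;> linarith
  -- φ is continuous only on U and may be unbounded. Z is a compact subset of U containing the whole
  -- orbit and K, so Tietze's theorem replaces φ by a bounded continuous function that agrees with
  -- it there.
  · set Z := (((fun n => T^[n] x) '' Set.Iio N) ∪ J) ∩ U with hZ
    have hZc : IsCompact Z := (((Set.finite_Iio N).image _).isCompact.union hJ).inter_right hU
    have hZx : ∀ n, T^[n] x ∈ Z := by
      intro n
      refine ⟨?_, hRU (hRn _ (hBR _ hx) n)⟩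
      rcases lt_or_ge n N with h | h
      · exact Or.inl ⟨n, h, rfl⟩
      · exact Or.inr (hBJ N x hx n h)
    have hKZ : K ⊆ Z := fun z hz => ⟨Or.inr (hKJ hz), hKU hz⟩
    have : CompactSpace Z := isCompact_iff_compactSpace.1 hZc
    obtain ⟨g, -, hg⟩ := BoundedContinuousFunction.exists_norm_eq_domRestrict_eq_of_closed
      (BoundedContinuousFunction.mkOfCompact
        (⟨Z.domRestrict φ, (hφ.mono Set.inter_subset_right).domRestrict⟩ : C(Z, ℝ))) hZc.isClosed
    have hgφ : ∀ z ∈ Z, g z = φ z := fun z hz => DFunLike.congr_fun hg ⟨z, hz⟩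
    have hKae : μ.restrict K = μ :=
      Measure.restrict_eq_self_of_ae_mem (mem_ae_iff.2 hμK)
    have hEqOn : Set.EqOn g φ K := fun z hz => hgφ z (hKZ hz)
    refine ⟨((g.integrable μ).integrableOn (s := K)).congr_fun hEqOn hKclosed.measurableSet, ?_⟩
    rw [← setIntegral_congr_fun hKclosed.measurableSet hEqOn, hKae, Metric.tendsto_atTop]
    intro ε hε
    have hx' : x ∈ B (max N N₀) := hB (le_max_left _ _) hx
    -- The average is within ε/4 + C/n < ε/2 of Λ for large n, and the integral is within ε/4 of the
    -- same Λ.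
    obtain ⟨Λ, C, h⟩ := (hlab (max N N₀)).birkhoff hJ (hBJ _) g (ε := ε / 4) (by linarith)
    have h2 := hμ.abs_integral_sub_le hKclosed hμK hO (hKJ.trans hJO)
      (hOB.trans (hB (le_max_right N N₀))) g h
    obtain ⟨n₁, hn₁⟩ := exists_nat_gt (max 0 (C / (ε / 4)))
    refine ⟨n₁, fun n hn => ?_⟩
    have hn0 : (max 0 (C / (ε / 4))) < (n : ℝ) := hn₁.trans_le (by exact_mod_cast hn)
    have hnpos : (0 : ℝ) < n := (le_max_left _ _).trans_lt hn0
    have hnC : C < n * (ε / 4) := by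
      rw [← div_lt_iff₀ (by linarith)]
      exact (le_max_right _ _).trans_lt hn0
    have h3 := h x hx' n
    have h4 : birkhoffAverage ℝ T φ n x = (n : ℝ)⁻¹ * ∑ j ∈ Finset.range n, g (T^[j] x) := by
      rw [birkhoffAverage, birkhoffSum, smul_eq_mul,
        Finset.sum_congr rfl fun j _ => hgφ _ (hZx j)]
    rw [h4, Real.dist_eq]
    have h5 : (n : ℝ)⁻¹ * ∑ j ∈ Finset.range n, g (T^[j] x) - ∫ z, g z ∂μ
        = (n : ℝ)⁻¹ * (∑ j ∈ Finset.range n, g (T^[j] x) - n * Λ) - (∫ z, g z ∂μ - Λ) := by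
      field_simp
      ring
    rw [h5]
    have h6 : |(n : ℝ)⁻¹ * (∑ j ∈ Finset.range n, g (T^[j] x) - n * Λ)| ≤ ε / 2 := by
      rw [abs_mul, abs_of_pos (inv_pos.2 hnpos), inv_mul_le_iff₀ hnpos]
      linarith
    have e1 := abs_le.1 h6
    have e2 := abs_le.1 h2
    rw [abs_lt]
    constructor <;> linarith

end Attractor

/-! ### The singular set has measure zero -/

section Null

variable {V : Fin 4 → ℝ × ℝ} {lam : ℝ}

lemma volume_singularRays (V : Fin 4 → ℝ × ℝ) : volume (singularRays V) = 0 := by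
  have h : singularRays V ⊆
      ⋃ i, (fun x => -V i + x) ⁻¹' (Submodule.span ℝ {V (i + 1) - V i} : Set (ℝ × ℝ)) := by
    rintro x ⟨i, s, -, rfl⟩
    refine Set.mem_iUnion.2 ⟨i, ?_⟩
    simp only [Set.mem_preimage, neg_add_cancel_left, SetLike.mem_coe]
    exact Submodule.smul_mem _ _ (Submodule.mem_span_singleton_self _)
  refine measure_mono_null h (measure_iUnion_null fun i => ?_)
  rw [measure_preimage_add]
  refine Measure.addHaar_submodule _ _ fun htop => ?_
  have h1 := finrank_span_le_card (R := ℝ) ({V (i + 1) - V i} : Set (ℝ × ℝ))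
  rw [htop, finrank_top] at h1
  simp at h1

/-- On each region the map is a similarity, so null sets pull back to null sets. The extra copy of N
accounts for points without a tangent vertex, where the map is the identity by convention. -/
lemma volume_preimage_outerMap (hlam : lam ≠ 0) {N : Set (ℝ × ℝ)} (hN : volume N = 0) :
    volume (outerMap V lam ⁻¹' N) = 0 := by
  have h : outerMap V lam ⁻¹' N ⊆
      N ∪ ⋃ i, (fun x => (-lam) • x) ⁻¹' ((fun x => (V i + lam • V i) + x) ⁻¹' N) := by
    intro x hx
    by_cases hi : ∃ i, IsTangentVertex V x i
    · obtain ⟨i, hi⟩ := hi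
      refine Or.inr (Set.mem_iUnion.2 ⟨i, ?_⟩)
      rw [Set.mem_preimage, hi.outerMap_eq] at hx
      simp only [Set.mem_preimage]
      convert hx using 1
      rw [smul_sub, neg_smul]
      abel
    · rw [Set.mem_preimage, outerMap, dif_neg hi] at hx
      exact Or.inl hx
  refine measure_mono_null h (measure_union_null hN (measure_iUnion_null fun i => ?_))
  rw [Measure.addHaar_preimage_smul _ (neg_ne_zero.2 hlam), measure_preimage_add, hN, mul_zero]

lemma volume_preimage_iterate (hlam : lam ≠ 0) (n : ℕ) :
    volume ((outerMap V lam)^[n] ⁻¹' singularRays V) = 0 := by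
  induction n with
  | zero => exact volume_singularRays V
  | succ n ih =>
    rw [Function.iterate_succ, Set.preimage_comp]
    exact volume_preimage_outerMap hlam ih

end Null

/-! ### The two thin rectangles lie in the basin -/

section Rectangles

variable {a b lam : ℝ}

lemma polygon_snd_le (h : Admissible a b lam) : polygon (quad a b) ⊆ {p | p.2 ≤ 1} := by
  refine convexHull_min ?_ (convex_halfSpace_le (LinearMap.snd ℝ ℝ ℝ).isLinear 1)
  rintro _ ⟨i, rfl⟩
  have := h.b_eq
  have := h.lam_pos
  fin_cases i <;> simp [quad]
  linarith

/-- The length is chosen so that 1 + lam - lam^2 l = a: reflections in D and C carry the left end E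
to B. -/
lemma sq_mul_lengthEA (h : Admissible a b lam) : lam ^ 2 * lengthEA a b = lam + (1 - a) := by
  have h1 : 1 - b = lam := by linarith [h.b_eq]
  have := h.lam_pos.ne'
  rw [lengthEA, h1]
  field_simp

lemma regularRect_nonempty (h : Admissible a b lam) {ε : ℝ} (hε0 : 0 < ε)
    (hε : ε < margin a lam) : (regularRect a b ε).Nonempty := by
  have hl := h.lam_pos
  have hl1 := h.lam_lt_one
  have hlen : ε < lengthEA a b := by
    have h1 := sq_mul_lengthEA h
    have h2 := margin_le h
    have h3 : lam ^ 2 * ε < lam ^ 2 * lengthEA a b := by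
      rw [h1]
      have := mul_lt_of_lt_one_left hε0 (pow_lt_one₀ hl.le hl1 two_ne_zero)
      linarith [h.a_lt_one]
    exact lt_of_mul_lt_mul_left h3 (by positivity)
  -- An open rectangle has positive area, so it is not covered by the null set of points with a
  -- singular iterate; being above y = 1, it misses the polygon.
  set G : Set (ℝ × ℝ) := Set.Ioo (-lengthEA a b + ε) 0 ×ˢ Set.Ioo 1 (1 + ε ^ 2) with hG
  have hGopen : IsOpen G := isOpen_Ioo.prod isOpen_Ioo
  have hGne : G.Nonempty := by
    refine Set.Nonempty.prod (Set.nonempty_Ioo.2 (by linarith)) (Set.nonempty_Ioo.2 ?_)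
    have : 0 < ε ^ 2 := by positivity
    linarith
  have hGpos := hGopen.measure_pos volume hGne
  have hnull : volume (⋃ n : ℕ, (outerMap (quad a b) lam)^[n] ⁻¹' singularRays (quad a b)) = 0 :=
    measure_iUnion_null fun n => volume_preimage_iterate hl.ne' n
  obtain ⟨p, hp, hpn⟩ : ∃ p ∈ G,
      p ∉ ⋃ n : ℕ, (outerMap (quad a b) lam)^[n] ⁻¹' singularRays (quad a b) := by
    by_contra! hcon
    exact hGpos.ne' (measure_mono_null hcon hnull)
  have hbl : 1 - b = lam := by linarith [h.b_eq]
  refine ⟨p, ?_, Or.inl ⟨⟨hp.1.1.le, hp.1.2.le⟩, ⟨hp.2.1.le, hp.2.2.le⟩⟩⟩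
  rw [hbl, regularSet_iff]
  refine ⟨fun hP => ?_, fun n hn => hpn (Set.mem_iUnion.2 ⟨n, hn⟩)⟩
  have h1 : p.2 ≤ 1 := polygon_snd_le h hP
  linarith [hp.2.1]

/-- Keeping a distance ε from E leaves a slack lam^2 ε in the strip inequality. The height enters
through lam ε^2, which is smaller because ε < lam; this explains the height ε^2. -/
lemma regularRect_subset_basin (h : Admissible a b lam) {ε : ℝ} (hε0 : 0 < ε)
    (hε : ε < margin a lam) : regularRect a b ε ⊆ basin a b lam 9 := by
  rintro ⟨u, y⟩ ⟨hreg, hrect⟩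
  have hl := h.lam_pos
  have hl1 := h.lam_lt_one
  have hbl : 1 - b = lam := by linarith [h.b_eq]
  have hm := margin_le h
  rw [hbl] at hreg
  obtain ⟨d, rfl⟩ : ∃ d, y = 1 + d := ⟨y - 1, by ring⟩
  have hsq : 0 ≤ ε ^ 2 := sq_nonneg ε
  obtain ⟨hu1, hu2, hd⟩ : -lengthEA a b + ε ≤ u ∧ u ≤ 0 ∧ |d| ≤ ε ^ 2 := by
    rcases hrect with ⟨⟨h1, h2⟩, h3, h4⟩ | ⟨⟨h1, h2⟩, h3, h4⟩ <;> simp only at h1 h2 h3 h4 <;>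
      exact ⟨h1, h2, abs_le.2 ⟨by linarith, by linarith⟩⟩
  have hsq1 : ε ^ 2 < lam * ε := by nlinarith
  have hdm : |d| < margin a lam := by nlinarith
  have hu0 : u < 0 :=
    lt_of_le_of_ne hu2 (fst_ne_zero hreg (by linarith [(abs_lt.1 hdm).1]))
  refine basin_mono (by norm_num) (mem_basin_of_strip h hreg hu0 hdm ?_)
  have h1 := sq_mul_lengthEA h
  have h2 := mul_le_mul_of_nonneg_left hu1 (by positivity : 0 ≤ lam ^ 2)
  have h3 : (1 - a) * lam * |d| ≤ lam * |d| := by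
    have : 0 ≤ a * (lam * |d|) := by
      have := h.a_pos
      positivity
    linarith
  have h4 := mul_le_mul_of_nonneg_left hd hl.le
  have h5 := mul_lt_mul_of_pos_left hsq1 hl
  linarith

lemma isCompact_trap : IsCompact (trap a lam) :=
  (isCompact_Icc.prod isCompact_Icc).union (isCompact_Icc.prod isCompact_Icc)

lemma isOpen_openTrap : IsOpen (openTrap a lam) :=
  (isOpen_Ioo.prod isOpen_Ioo).union (isOpen_Ioo.prod isOpen_Ioo)

lemma trap_subset_openTrap (h : Admissible a b lam) : trap a lam ⊆ openTrap a lam := by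
  have hm := margin_pos h
  have h3 : lam ^ 3 * margin a lam < margin a lam :=
    mul_lt_of_lt_one_left hm (pow_lt_one₀ h.lam_pos.le h.lam_lt_one (by norm_num))
  rintro p (⟨⟨h1, h2⟩, h4, h5⟩ | ⟨⟨h1, h2⟩, h4, h5⟩)
  · exact Or.inl ⟨⟨by linarith, by linarith⟩, by linarith, by linarith⟩
  · exact Or.inr ⟨⟨by linarith, by linarith⟩, by linarith, by linarith⟩

end Rectangles

/-! ### Global attraction for lam = 3/5 -/

section Global

variable {a b lam : ℝ}

lemma mem_region_of_mem_regularSet (h : Admissible a b lam) {p : ℝ × ℝ}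
    (hp : p ∈ regularSet (quad a b) lam) :
    p ∈ regionA ∨ p ∈ regionB a lam ∨ p ∈ regionC a b lam ∨ p ∈ regionD b :=
  mem_region h (notMem_polygon hp) (notMem_singularRays hp)

/-- A family of squares that shrink under the map when `lam = 3 / 5`. -/
def shrinkingBox (e : ℝ) : Set (ℝ × ℝ) :=
  Set.Icc (-(3 / 2 + e)) (5 / 2 + e) ×ˢ Set.Icc (-(3 / 2 + e)) (5 / 2 + e)

/-- Vertex coordinates lie in [0, 1], so each coordinate is mapped by t ↦ (8/5) v - (3/5) t with v
in [0, 1]. The interval [-3/2, 5/2] is mapped into itself, and any excess over it shrinks by 3/5. -/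
lemma outerMap_mem_shrinkingBox (h : Admissible a b lam) (hlam : lam = 3 / 5) {p : ℝ × ℝ} {e : ℝ}
    (hp : p ∈ regularSet (quad a b) lam) (hpe : p ∈ shrinkingBox e) :
    outerMap (quad a b) lam p ∈ shrinkingBox (3 / 5 * e) := by
  obtain ⟨x, y⟩ := p
  obtain ⟨⟨h1, h2⟩, h3, h4⟩ := hpe
  simp only at h1 h2 h3 h4
  have ha0 := h.a_pos
  have ha1 := h.a_lt_one
  rcases mem_region_of_mem_regularSet h hp with hr | hr | hr | hr
  · rw [outerMap_A h hr, hlam]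
    exact ⟨⟨by simp only; linarith, by simp only; linarith⟩, by simp only; linarith,
      by simp only; linarith⟩
  · rw [outerMap_B h hr, hlam]
    exact ⟨⟨by simp only; linarith, by simp only; linarith⟩, by simp only; linarith,
      by simp only; linarith⟩
  · rw [outerMap_C h hr, hlam]
    exact ⟨⟨by simp only; linarith, by simp only; linarith⟩, by simp only; linarith,
      by simp only; linarith⟩
  · rw [outerMap_D h hr, hlam]
    exact ⟨⟨by simp only; linarith, by simp only; linarith⟩, by simp only; linarith,
      by simp only; linarith⟩

/-- The point is at height at most `r` above or below the line `y = 1`, or the line `y = -3 / 5` if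
it is reflected in the vertex `C`. -/
def NearLine (a b lam r : ℝ) (p : ℝ × ℝ) : Prop :=
  (p ∈ regionC a b lam ∧ |p.2 + 3 / 5| ≤ r) ∨
    ((p ∈ regionA ∨ p ∈ regionB a lam ∨ p ∈ regionD b) ∧ |p.2 - 1| ≤ r)

/-- Reflections in A and B preserve the line y = 1; D carries it to y = -3/5 and C carries that line
back, each with factor -3/5. Inside the box the possible successions of regions are restricted: D is
followed by C, C never by C, A by D, and B by A or D. -/
lemma nearLine_outerMap (h : Admissible a b lam) (hlam : lam = 3 / 5) (ha : a ≤ 1 / 2)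
    {p : ℝ × ℝ} {r : ℝ} (hp : p ∈ regularSet (quad a b) lam) (hpe : p ∈ shrinkingBox (1 / 100))
    (hpr : NearLine a b lam r p) :
    NearLine a b lam (3 / 5 * r) (outerMap (quad a b) lam p) ∧
      (p ∈ regionA → outerMap (quad a b) lam p ∈ regionD b) ∧
      (p ∈ regionB a lam →
        outerMap (quad a b) lam p ∈ regionA ∨ outerMap (quad a b) lam p ∈ regionD b) ∧
      (p ∈ regionC a b lam → outerMap (quad a b) lam p ∈ regionA ∨
        outerMap (quad a b) lam p ∈ regionB a lam ∨ outerMap (quad a b) lam p ∈ regionD b) := by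
  obtain ⟨x, y⟩ := p
  obtain ⟨⟨h1, h2⟩, h3, h4⟩ := hpe
  simp only at h1 h2 h3 h4
  have ha0 := h.a_pos
  have hb : b = 2 / 5 := by rw [h.b_eq, hlam]; norm_num
  have hreg := outerMap_mem_regularSet h hp
  have habs : ∀ t s : ℝ, t = -(3 / 5) * s → |s| ≤ r → |t| ≤ 3 / 5 * r := by
    intro t s hts hs
    rw [hts, abs_mul]
    norm_num
    linarith
  rcases mem_region_of_mem_regularSet h hp with hr | hr | hr | hr
  · have hD : outerMap (quad a b) lam (x, y) ∈ regionD b := by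
      obtain ⟨e1, e2⟩ := hr
      rw [outerMap_A h ⟨e1, e2⟩, hlam, hb]
      simp only at e1 e2
      exact ⟨by simp only; linarith, by simp only; linarith⟩
    have hy : |y - 1| ≤ r := by
      rcases hpr with ⟨hc, -⟩ | ⟨-, hy⟩
      · have e1 := hc.1
        have e2 := hc.2
        simp only [hlam, hb] at e1 e2
        have e3 := hr.1
        have e4 := hr.2
        simp only at e3 e4
        nlinarith
      · exact hy
    refine ⟨Or.inr ⟨Or.inr (Or.inr hD), ?_⟩, fun _ => hD, fun hB => ?_, fun _ => Or.inr (Or.inr hD)⟩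
    · refine habs _ _ ?_ hy
      rw [outerMap_A h hr, hlam]
      simp only
      ring
    · exact absurd hB.1 (by have := hr.2; simp only at this ⊢; linarith)
  · have hy1 := hr.1
    simp only at hy1
    have hup : 1 < (outerMap (quad a b) lam (x, y)).2 := by
      rw [outerMap_B h hr, hlam]
      simp only
      linarith
    have hAD : outerMap (quad a b) lam (x, y) ∈ regionA ∨
        outerMap (quad a b) lam (x, y) ∈ regionD b := by
      rcases mem_region_of_mem_regularSet h hreg with hq | hq | hq | hq
      · exact Or.inl hq
      · exact absurd hq.1 (not_lt.2 hup.le)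
      · exfalso
        rw [outerMap_B h hr] at hq
        have e1 := hq.1
        have e2 := hq.2
        rw [outerMap_B h hr] at hup
        simp only [hlam, hb] at e1 e2 hup
        nlinarith
      · exact Or.inr hq
    have hy : |y - 1| ≤ r := by
      rcases hpr with ⟨hc, -⟩ | ⟨-, hy⟩
      · exact absurd hc.2 (not_lt.2 hr.2.le)
      · exact hy
    refine ⟨Or.inr ⟨by tauto, ?_⟩, fun hA => ?_, fun _ => hAD, fun _ => by tauto⟩
    · refine habs _ _ ?_ hy
      rw [outerMap_B h hr, hlam]
      simp only
      ring
    · exact absurd hA.2 (not_lt.2 hr.1.le)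
  · have hABD : outerMap (quad a b) lam (x, y) ∈ regionA ∨
        outerMap (quad a b) lam (x, y) ∈ regionB a lam ∨
        outerMap (quad a b) lam (x, y) ∈ regionD b := by
      rcases mem_region_of_mem_regularSet h hreg with hq | hq | hq | hq
      · exact Or.inl hq
      · exact Or.inr (Or.inl hq)
      · exfalso
        rw [outerMap_C h hr] at hq
        have e1 := hq.1
        have e2 := hr.1
        simp only [hlam, hb] at e1 e2
        linarith
      · exact Or.inr (Or.inr hq)
    have hy : |y + 3 / 5| ≤ r := by
      rcases hpr with ⟨-, hy⟩ | ⟨hc | hc | hc, -⟩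
      · exact hy
      · have e1 := hr.1
        have e2 := hr.2
        have e3 := hc.1
        have e4 := hc.2
        simp only [hlam, hb] at e1 e2 e3 e4
        nlinarith
      · exact absurd hc.2 (not_lt.2 hr.2.le)
      · exact absurd hc.2 (not_lt.2 hr.1.le)
    refine ⟨Or.inr ⟨hABD, ?_⟩, fun hA => ?_, fun hB => ?_, fun _ => hABD⟩
    · refine habs _ _ ?_ hy
      rw [outerMap_C h hr, hlam]
      simp only
      ring
    · have e1 := hr.1
      have e2 := hr.2
      have e3 := hA.1
      have e4 := hA.2
      simp only [hlam, hb] at e1 e2 e3 e4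
      nlinarith
    · exact absurd hB.2 (not_lt.2 hr.2.le)
  · obtain ⟨e1, e2⟩ := hr
    simp only at e1 e2
    have hC : outerMap (quad a b) lam (x, y) ∈ regionC a b lam := by
      rw [outerMap_D h ⟨e1, e2⟩]
      rw [hb] at e2
      refine ⟨by simp only [hb, hlam]; linarith, ?_⟩
      simp only [hlam]
      nlinarith
    have hy : |y - 1| ≤ r := by
      rcases hpr with ⟨hc, -⟩ | ⟨-, hy⟩
      · exact absurd hc.1 (not_lt.2 e2.le)
      · exact hy
    refine ⟨Or.inl ⟨hC, ?_⟩, fun hA => ?_, fun hB => ?_, fun hC' => ?_⟩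
    · refine habs _ _ ?_ hy
      rw [outerMap_D h ⟨e1, e2⟩, hlam]
      simp only
      ring
    · exact absurd hA.1 (not_lt.2 e1.le)
    · exfalso
      have e3 := hB.1
      have e4 := hB.2
      simp only [hlam] at e3 e4
      nlinarith
    · exact absurd hC'.1 (not_lt.2 e2.le)

/-- For `lam = 3 / 5` and `a ≤ 1 / 2`, every regular point is attracted. -/
theorem exists_mem_basin (h : Admissible a b lam) (hlam : lam = 3 / 5) (ha : a ≤ 1 / 2)
    {p : ℝ × ℝ} (hp : p ∈ regularSet (quad a b) lam) : ∃ N, p ∈ basin a b lam N := by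
  set T := outerMap (quad a b) lam with hT
  have hreg := iterate_mem_regularSet h hp
  have hm := margin_pos h
  have hbox : ∀ n, T^[n] p ∈ shrinkingBox ((3 / 5) ^ n * (|p.1| + |p.2|)) := by
    intro n
    induction n with
    | zero =>
      have e1 := neg_abs_le p.1
      have e2 := le_abs_self p.1
      have e3 := neg_abs_le p.2
      have e4 := le_abs_self p.2
      have e5 := abs_nonneg p.1
      have e6 := abs_nonneg p.2
      simp only [pow_zero, one_mul, Function.iterate_zero, id]
      exact ⟨⟨by linarith, by linarith⟩, by linarith, by linarith⟩
    | succ n ih =>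
      rw [Function.iterate_succ_apply', pow_succ', mul_assoc]
      exact outerMap_mem_shrinkingBox h hlam (hreg n) ih
  have hsmall : ∀ {c : ℝ} (M : ℝ), 0 < c → ∃ n : ℕ, ∀ m ≥ n, (3 / 5 : ℝ) ^ m * M < c := by
    intro c M hc
    have h1 : Tendsto (fun n : ℕ => (3 / 5 : ℝ) ^ n * M) atTop (𝓝 (0 * M)) :=
      (tendsto_pow_atTop_nhds_zero_of_lt_one (by norm_num) (by norm_num)).mul_const M
    rw [zero_mul] at h1
    exact eventually_atTop.1 (h1.eventually (gt_mem_nhds hc))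
  obtain ⟨n₀, hn₀⟩ := hsmall (|p.1| + |p.2|) (by norm_num : (0 : ℝ) < 1 / 100)
  have hbox' : ∀ n, T^[n + n₀] p ∈ shrinkingBox (1 / 100) := by
    intro n
    have h1 := hn₀ (n + n₀) (Nat.le_add_left _ _)
    obtain ⟨⟨e1, e2⟩, e3, e4⟩ := hbox (n + n₀)
    exact ⟨⟨by linarith, by linarith⟩, by linarith, by linarith⟩
  obtain ⟨r, hr⟩ : ∃ r, NearLine a b lam r (T^[n₀] p) := by
    rcases mem_region_of_mem_regularSet h (hreg n₀) with
      hq | hq | hq | hq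
    · exact ⟨_, Or.inr ⟨Or.inl hq, le_rfl⟩⟩
    · exact ⟨_, Or.inr ⟨Or.inr (Or.inl hq), le_rfl⟩⟩
    · exact ⟨_, Or.inl ⟨hq, le_rfl⟩⟩
    · exact ⟨_, Or.inr ⟨Or.inr (Or.inr hq), le_rfl⟩⟩
  have hnear : ∀ n, NearLine a b lam ((3 / 5) ^ n * r) (T^[n + n₀] p) := by
    intro n
    induction n with
    | zero => simpa using hr
    | succ n ih =>
      rw [show n + 1 + n₀ = n + n₀ + 1 by ring, Function.iterate_succ_apply', pow_succ', mul_assoc]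
      exact (nearLine_outerMap h hlam ha (hreg _) (hbox' n) ih).1
  obtain ⟨n₁, hn₁⟩ := hsmall r hm
  have hstep : ∀ n, _ := fun n =>
    (nearLine_outerMap h hlam ha (hreg (n + n₀)) (hbox' n) (hnear n)).2
  simp only [← hT, ← Function.iterate_succ_apply' T] at hstep
  obtain ⟨n, hn, hD⟩ : ∃ n ≥ n₁, T^[n + n₀] p ∈ regionD b := by
    have hA : ∀ n ≥ n₁, T^[n + n₀] p ∈ regionA → ∃ n ≥ n₁, T^[n + n₀] p ∈ regionD b :=
      fun n hn hA => ⟨n + 1, by omega, by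
        rw [show n + 1 + n₀ = n + n₀ + 1 by ring]; exact (hstep n).1 hA⟩
    have hB : ∀ n ≥ n₁, T^[n + n₀] p ∈ regionB a lam → ∃ n ≥ n₁, T^[n + n₀] p ∈ regionD b := by
      intro n hn hB
      have h1 := (hstep n).2.1 hB
      rw [Nat.succ_eq_add_one, show n + n₀ + 1 = n + 1 + n₀ by ring] at h1
      rcases h1 with h1 | h1
      · exact hA (n + 1) (by omega) h1
      · exact ⟨n + 1, by omega, h1⟩
    rcases mem_region_of_mem_regularSet h (hreg (n₁ + n₀))
      with hq | hq | hq | hq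
    · exact hA n₁ le_rfl hq
    · exact hB n₁ le_rfl hq
    · have h1 := (hstep n₁).2.2 hq
      rw [Nat.succ_eq_add_one, show n₁ + n₀ + 1 = n₁ + 1 + n₀ by ring] at h1
      rcases h1 with h1 | h1 | h1
      · exact hA (n₁ + 1) (by omega) h1
      · exact hB (n₁ + 1) (by omega) h1
      · exact ⟨n₁ + 1, by omega, h1⟩
    · exact ⟨n₁, le_rfl, hq⟩
  refine ⟨6 + (n + n₀), mem_basin_of_iterate hp ?_⟩
  have hregn := hreg (n + n₀)
  have hnr := hnear n
  have hbn := hbox' n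
  have hrn := hn₁ n hn
  rw [← hT]
  rw [← hT] at hregn
  generalize T^[n + n₀] p = q at *
  obtain ⟨u, y⟩ := q
  obtain ⟨d, rfl⟩ : ∃ d, y = 1 + d := ⟨y - 1, by ring⟩
  have hu := hD.1
  have hd : |d| < margin a lam := by
    rcases hnr with ⟨hc, -⟩ | ⟨-, hc⟩
    · exact absurd hc.1 (not_lt.2 hD.2.le)
    · simp only [add_sub_cancel_left] at hc
      linarith
  -- In the box u ≥ -1.51, so lam^2 u ≥ -0.55, while 1 + lam - a ≥ 1.1; the term in |d| is below the
  -- margin.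
  refine mem_basin_of_strip h hregn hu hd ?_
  have hm' := margin_le h
  have hu1 := hbn.1.1
  simp only at hu1
  have h1 : (1 - a) * lam * |d| ≤ 1 * |d| := by
    refine mul_le_mul_of_nonneg_right ?_ (abs_nonneg d)
    rw [hlam]
    linarith [h.a_pos]
  rw [hlam] at hm' h1 ⊢
  rw [hlam] at hd
  linarith

end Global

end OuterBilliard

/-! ### The main theorem -/

open OuterBilliard

theorem mainTheorem5 (a b : ℝ) (ha0 : 0 < a) (ha1 : a < 1) (hb0 : 0 < b) (hb1 : b < 1)
    (hab : a + b ≤ 1) (hlam : a < 1 + (1 - b) - (1 - b) ^ 3 - (1 - b) ^ 4) :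
    ∃ K : Set (ℝ × ℝ), OuterBilliard.IsAttractor a b K ∧
      ∃ μ : Measure (ℝ × ℝ),
        (OuterBilliard.IsInvariantProb (OuterBilliard.quad a b) (1 - b) μ ∧ μ Kᶜ = 0) ∧
        (∀ ν : Measure (ℝ × ℝ),
          OuterBilliard.IsInvariantProb (OuterBilliard.quad a b) (1 - b) ν → ν Kᶜ = 0 → ν = μ) ∧
        (∃ ε₀ > 0, ∀ ε, 0 < ε → ε < ε₀ → ∀ x ∈ OuterBilliard.regularRect a b ε,
          OuterBilliard.BirkhoffConverges (OuterBilliard.quad a b) (1 - b) K μ x) ∧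
        (b = 2 / 5 → 2 / 5 ≤ a → a ≤ 1 / 2 →
          ∀ x ∈ OuterBilliard.regularSet (OuterBilliard.quad a b) (1 - b),
            OuterBilliard.BirkhoffConverges (OuterBilliard.quad a b) (1 - b) K μ x) := by
  have h : Admissible a b (1 - b) :=
    ⟨ha0, ha1, hb0, by linarith, by ring, by linarith, by linarith⟩
  have hm := margin_pos h
  obtain ⟨x₀, hx₀⟩ := regularRect_nonempty h (half_pos hm) (half_lt_self hm)
  -- All basins share one attractor: 9 steps suffice from the rectangles and from the neighbourhood
  -- `openTrap`, and larger basins serve for the global statement.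
  obtain ⟨K, hK, μ, hμ, huniq, hbirk⟩ := exists_uniquely_ergodic_attractor
    (T := outerMap (quad a b) (1 - b)) (R := regularSet (quad a b) (1 - b))
    (U := (interior (polygon (quad a b)))ᶜ) (B := basin a b (1 - b)) (J := trap a (1 - b))
    (O := openTrap a (1 - b)) (N₀ := 9) (x₀ := x₀) (fun _ hx => outerMap_mem_regularSet h hx)
    isOpen_interior.isClosed_compl (fun _ hx hi => notMem_polygon hx (interior_subset hi))
    (fun _ _ => basin_mono) (fun _ _ hx => hx.1) (hasUniformLabels_basin h) isCompact_trap
    (fun _ _ hx _ hn => iterate_mem_trap h hx hn) isOpen_openTrap (trap_subset_openTrap h)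
    (fun _ hx => mem_basin_of_mem_openTrap h hx.1 hx.2)
    (regularRect_subset_basin h (half_pos hm) (half_lt_self hm) hx₀)
  refine ⟨K, ⟨_, hm, fun ε hε0 hε => ⟨regularRect_nonempty h hε0 hε, fun p hp => ?_⟩⟩,
    μ, hμ, huniq, ⟨_, hm, fun ε hε0 hε x hx => ?_⟩, fun hb _ ha x hx => ?_⟩
  · exact hK 9 p (regularRect_subset_basin h hε0 hε hp)
  · exact fun φ hφ => hbirk 9 x (regularRect_subset_basin h hε0 hε hx) φ hφ
  · obtain ⟨N, hN⟩ := exists_mem_basin h (by rw [hb]; norm_num) ha hx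
    exact fun φ hφ => hbirk N x hN φ hφ
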